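/- Let $n>1$. Regard $\mathbb{C}S_n$ as a superalgebra whose even (resp. odd) part is spanned by the even (resp. odd) permutations. A $\mathbb{C}S_n$-supermodule is a $\mathbb{C}S_n$-module $V=V_{\bar 0}\oplus V_{\bar 1}$ with $(\mathbb{C}S_n)_i V_j\subseteq V_{i+j}$; it is simple if it is nonzero and has no subsupermodules (graded submodules) other than $0$ and $V$, and a simple supermodule is of Type M if it is simple as an ordinary $\mathbb{C}S_n$-module, and of Type Q otherwise. A homogeneous isomorphism of supermodules is a bijective linear map $f$ which is even or odd and satisfies $f(av)=(-1)^{\bar a\bar f}a f(v)$ for homogeneous $a$. For $\lambda\vdash n$ let $S^\lambda$ be the Specht module and $\lambda'$ the conjugate partition. There exist linear maps $\phi^\lambda:S^\lambda\to S^{\lambda'}$ ($\lambda\vdash n$) such that $\phi^\lambda(\sigma v)=\operatorname{sgn}(\sigma)\,\sigma\phi^\lambda(v)$ for all $\sigma\in S_n$, $v\in S^\lambda$, and $\phi^{\lambda'}\circ\phi^\lambda=\mathrm{id}_{S^\lambda}$. Fix any such family. For $\lambda=\lambda'$ let $S^{\lambda^+}$ and $S^{\lambda^-}$ be the $+1$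 and $-1$ eigenspaces of $\phi^\lambda$ on $S^\lambda$. Let $\overline{\mathcal P}(n)$ be any set of representatives for the classes $\{\lambda,\lambda'\}$ of partitions of $n$. Then there are $\mathbb{C}S_n$-supermodules $W^\lambda$, $\lambda\in\overline{\mathcal P}(n)$, such that: 1. If $\lambda\neq\lambda'$, then $W^\lambda$ is a simple supermodule of Type Q, and there is an isomorphism $W^\lambda\cong S^\lambda\oplus S^{\lambda'}$ of ordinary $\mathbb{C}S_n$-modules under which $$W^\lambda_{\bar 0}=\{u+\phi^\lambda(u):u\in S^\lambda\},\qquad W^\lambda_{\bar 1}=\{u-\phi^\lambda(u):u\in S^\lambda\}.$$ This decomposition is canonical: the two summands are the only $\mathbb{C}S_n$-submodules of $W^\lambda$ isomorphic to $S^\lambda$ and to $S^{\lambda'}$, respectively. There is a unique linear map $J^\lambda:W^\lambda\to W^\lambda$ with $J^\lambda(u\pm\phi^\lambda(u))=u\mp\phi^\lambda(u)$ for $u\in S^\lambda$, and it is an odd involution (it reverses parity and $J^\lambda\circ J^\lambda=\mathrm{id}$). 2. If $\lambda=\lambda'$, then $W^\lambda$ is a simple supermodule of Type M, and there is an isomorphism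 $W^\lambda\cong S^\lambda$ of ordinary $\mathbb{C}S_n$-modules under which $W^\lambda_{\bar 0}=S^{\lambda^+}$ and $W^\lambda_{\bar 1}=S^{\lambda^-}$. 3. The set $\{W^\lambda:\lambda\in\overline{\mathcal P}(n)\}$ is a complete set of pairwise non-isomorphic simple $\mathbb{C}S_n$-supermodules up to homogeneous isomorphism: every simple $\mathbb{C}S_n$-supermodule is isomorphic to some $W^\lambda$ via an even or odd isomorphism, and for $\lambda\neq\mu$ in $\overline{\mathcal P}(n)$ there is no even or odd isomorphism between $W^\lambda$ and $W^\mu$. -/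

import Mathlib

universe u v w

noncomputable section


/-! ### Superalgebras and supermodules over `ℂ` -/

/-- A (left) supermodule over the superalgebra `A = 𝒜 0 ⊕ 𝒜 1`: an `A`-module `V = V₀ ⊕ V₁`
such that `𝒜 i • V j ⊆ V (i + j)`. -/
structure Supermodule {A : Type v} [Ring A] [Algebra ℂ A] (𝒜 : ZMod 2 → Submodule ℂ A)
    [GradedAlgebra 𝒜] where
  carrier : Type u
  [instAddCommGroup : AddCommGroup carrier]
  [instModuleC : Module ℂ carrier]
  [instModule : Module A carrier]
  [instIsScalarTower : IsScalarTower ℂ A carrier]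
  /-- `grade 0` is the even part and `grade 1` the odd part. -/
  grade : ZMod 2 → Submodule ℂ carrier
  isCompl : IsCompl (grade 0) (grade 1)
  smul_mem : ∀ (i j : ZMod 2) (a : A) (v : carrier),
    a ∈ 𝒜 i → v ∈ grade j → a • v ∈ grade (i + j)

namespace Supermodule

attribute [instance] instAddCommGroup instModuleC instModule instIsScalarTower

variable {A : Type v} [Ring A] [Algebra ℂ A] {𝒜 : ZMod 2 → Submodule ℂ A} [GradedAlgebra 𝒜]

/-- The `A`-submodule `N` is a subsupermodule, i.e. it contains the homogeneous components of
its elements. -/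
def IsSubsupermodule (V : Supermodule.{u} 𝒜) (N : Submodule A V.carrier) : Prop :=
  ∀ x ∈ V.grade 0, ∀ y ∈ V.grade 1, x + y ∈ N → x ∈ N ∧ y ∈ N

/-- `V` is nonzero and its only subsupermodules are `0` and `V`. -/
def IsSimple (V : Supermodule.{u} 𝒜) : Prop :=
  Nontrivial V.carrier ∧
    ∀ N : Submodule A V.carrier, V.IsSubsupermodule N → N = ⊥ ∨ N = ⊤

/-- A simple supermodule which is simple as an ordinary module. -/
def IsSimpleTypeM (V : Supermodule.{u} 𝒜) : Prop :=
  V.IsSimple ∧ IsSimpleModule A V.carrier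

/-- A simple supermodule which is not simple as an ordinary module. -/
def IsSimpleTypeQ (V : Supermodule.{u} 𝒜) : Prop :=
  V.IsSimple ∧ ¬ IsSimpleModule A V.carrier

/-- The linear map `f` is a supermodule homomorphism that is homogeneous of superdegree `p`:
`f (V i) ⊆ W (i + p)`, and `f (a • v) = (-1) ^ (deg a * p) a • f v` for homogeneous `a`. -/
def IsHomOfDegree {V : Supermodule.{u} 𝒜} {W : Supermodule.{w} 𝒜} (p : ZMod 2)
    (f : V.carrier →ₗ[ℂ] W.carrier) : Prop :=
  (∀ i, ∀ x ∈ V.grade i, f x ∈ W.grade (i + p)) ∧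
    ∀ i, ∀ a ∈ 𝒜 i, ∀ x, f (a • x) = (-1 : ℂ) ^ (i.val * p.val) • a • f x

/-- Isomorphism via a homogeneous (even or odd) supermodule isomorphism. -/
def HomogeneouslyIsomorphic (V : Supermodule.{u} 𝒜) (W : Supermodule.{w} 𝒜) : Prop :=
  ∃ (p : ZMod 2) (f : V.carrier →ₗ[ℂ] W.carrier),
    IsHomOfDegree p f ∧ Function.Bijective f

/-- An odd involution of the underlying superspace: `J (V i) ⊆ V (i + 1)` and `J ∘ J = id`. -/
def IsOddInvolution (V : Supermodule.{u} 𝒜) (J : V.carrier →ₗ[ℂ] V.carrier) : Prop :=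
  (∀ i, ∀ x ∈ V.grade i, J x ∈ V.grade (i + 1)) ∧ ∀ x, J (J x) = x

end Supermodule

/-! ### The group superalgebra of the symmetric group -/

/-- The group algebra `ℂ S_n`. -/
abbrev GroupAlgSn (n : ℕ) : Type := MonoidAlgebra ℂ (Equiv.Perm (Fin n))

/-- The parity of a permutation. -/
def permParity {n : ℕ} (σ : Equiv.Perm (Fin n)) : ZMod 2 :=
  if Equiv.Perm.sign σ = 1 then 0 else 1

theorem permParity_mul {n : ℕ} (σ τ : Equiv.Perm (Fin n)) :
    permParity (σ * τ) = permParity σ + permParity τ := by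
  rcases Int.units_eq_one_or (Equiv.Perm.sign σ) with h | h <;>
    rcases Int.units_eq_one_or (Equiv.Perm.sign τ) with h' | h' <;>
    simp [permParity, h, h']; decide

/-- The `ℤ/2`-grading on `ℂ S_n`: degree `0` is the span of the even permutations, degree `1` the
span of the odd ones. -/
def snGrading (n : ℕ) (i : ZMod 2) : Submodule ℂ (GroupAlgSn n) :=
  Submodule.span ℂ (MonoidAlgebra.of ℂ (Equiv.Perm (Fin n)) '' {σ | permParity σ = i})

theorem snGrading_coeff {n : ℕ} {i : ZMod 2} {x : GroupAlgSn n} (hx : x ∈ snGrading n i)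
    {σ : Equiv.Perm (Fin n)} (hσ : permParity σ ≠ i) : x.coeff σ = 0 := by
  induction hx using Submodule.span_induction with
  | mem x h =>
    obtain ⟨τ, hτ, rfl⟩ := h
    have : τ ≠ σ := by rintro rfl; exact hσ hτ
    simp [MonoidAlgebra.of_apply, this]
  | zero => simp
  | add x y _ _ hx hy => simp [hx, hy]
  | smul c x _ hx => simp [hx]

theorem snGrading_isCompl (n : ℕ) : IsCompl (snGrading n 0) (snGrading n 1) := by
  constructor
  · rw [Submodule.disjoint_def]
    intro x h0 h1
    ext σ
    by_cases h : permParity σ = 0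
    · exact snGrading_coeff h1 (by rw [h]; decide)
    · exact snGrading_coeff h0 h
  · rw [codisjoint_iff, eq_top_iff]
    intro x _
    induction x using MonoidAlgebra.induction_on with
    | of σ =>
      by_cases h : permParity σ = 0
      · exact Submodule.mem_sup_left (Submodule.subset_span ⟨σ, h, rfl⟩)
      · refine Submodule.mem_sup_right (Submodule.subset_span ⟨σ, ?_, rfl⟩)
        unfold permParity at h ⊢
        split_ifs at h ⊢ <;> simp_all
    | add x y hx hy => exact Submodule.add_mem _ (hx trivial) (hy trivial)
    | smul c x hx => exact Submodule.smul_mem _ c (hx trivial)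

instance snGradedAlgebra (n : ℕ) : GradedAlgebra (snGrading n) where
  one_mem := Submodule.subset_span ⟨1, by simp [permParity], map_one _⟩
  mul_mem := by
    intro i j a b ha hb
    have h := Submodule.mul_mem_mul ha hb
    rw [snGrading, snGrading, Submodule.span_mul_span] at h
    refine Submodule.span_mono ?_ h
    rintro _ ⟨_, ⟨σ, hσ, rfl⟩, _, ⟨τ, hτ, rfl⟩, rfl⟩
    refine ⟨σ * τ, ?_, map_mul _ _ _⟩
    rw [Set.mem_ofPred_eq] at hσ hτ ⊢
    rw [permParity_mul, hσ, hτ]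
  toDecomposition := ((DirectSum.isInternal_submodule_iff_isCompl (snGrading n)
    (i := 0) (j := 1) (by decide) (Set.ext fun i => by simpa using (by decide : ∀ i : ZMod 2, i = 0 ∨ i = 1) i)).2
      (snGrading_isCompl n)).chooseDecomposition

/-! ### Partitions and Specht modules -/

/-- Partitions of `n`, as Young diagrams with `n` cells; the cell `(i, j)` is in row `i` and
column `j`. -/
abbrev Ptn (n : ℕ) : Type := {μ : YoungDiagram // μ.card = n}

/-- The conjugate (transpose) partition. -/
def Ptn.conj {n : ℕ} (μ : Ptn n) : Ptn n :=
  ⟨μ.1.transpose, by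
    refine Eq.trans ?_ μ.2
    exact Finset.card_bij (fun c _ => c.swap)
      (fun c hc => by simpa [YoungDiagram.mem_transpose] using hc)
      (fun a _ b _ h => Prod.swap_injective h)
      (fun b hb => ⟨b.swap, by simpa [YoungDiagram.mem_transpose] using hb, by simp⟩)⟩

/-- `R` is a set of representatives for the classes `{μ, μ'}` of partitions of `n`. -/
def IsConjRepresentatives {n : ℕ} (R : Set (Ptn n)) : Prop :=
  ∀ μ : Ptn n, ∃! ν, ν ∈ R ∧ (ν = μ ∨ ν = μ.conj)

/-- Functions assigning a row index to each of the letters. A tabloid (a tableau up to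
permutations within its rows) is the same thing as the assignment of a row to each letter. -/
def RowAssignment (n : ℕ) : Type := Fin n → ℕ

/-- Permutations act by permuting the letters: `σ k` lies in the row in which `k` was. -/
instance (n : ℕ) : MulAction (Equiv.Perm (Fin n)) (RowAssignment n) where
  smul σ f := fun k => f (σ⁻¹ k)
  one_smul _ := rfl
  mul_smul σ τ f := by
    funext k
    change f ((σ * τ)⁻¹ k) = f (τ⁻¹ (σ⁻¹ k))
    rw [mul_inv_rev]
    rfl

/-- The permutation module on all row assignments. It contains, for each partition `μ` of `n`, the
permutation module `M^μ` spanned by the tabloids of shape `μ`. -/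
abbrev TabloidModule (n : ℕ) : Type :=
  (Representation.ofMulAction ℂ (Equiv.Perm (Fin n)) (RowAssignment n)).asModule

/-- A tableau of shape `μ`: a bijection sending each letter to the cell that it occupies. -/
abbrev Tableau {n : ℕ} (μ : Ptn n) : Type := Fin n ≃ μ.1.cells

/-- The tabloid of a tableau, as an element of the permutation module. -/
def Tableau.tabloid {n : ℕ} {μ : Ptn n} (T : Tableau μ) : TabloidModule n :=
  (Representation.asModuleEquiv _).symm
    (MonoidAlgebra.single (show RowAssignment n from fun k => (T k).1.1) (1 : ℂ))

/-- The signed sum `∑ sgn(π) π` over the column stabilizer of a tableau. -/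
def Tableau.columnAntisymmetrizer {n : ℕ} {μ : Ptn n} (T : Tableau μ) : GroupAlgSn n :=
  ∑ π : Equiv.Perm (Fin n) with ∀ k, (T (π k)).1.2 = (T k).1.2,
    MonoidAlgebra.single π ((Equiv.Perm.sign π : ℤ) : ℂ)

/-- The polytabloid of a tableau. -/
def Tableau.polytabloid {n : ℕ} {μ : Ptn n} (T : Tableau μ) : TabloidModule n :=
  T.columnAntisymmetrizer • T.tabloid

/-- The Specht module `S^μ`: the submodule generated by the polytabloids of shape `μ`. -/
def specht {n : ℕ} (μ : Ptn n) : Submodule (GroupAlgSn n) (TabloidModule n) :=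
  Submodule.span (GroupAlgSn n) (Set.range (Tableau.polytabloid (μ := μ)))

/-- A choice of maps `φ^μ : S^μ → S^{μ'}` with `φ^μ (σ v) = sgn(σ) σ φ^μ(v)` and
`φ^{μ'} ∘ φ^μ = id`. The last equation is read in the common ambient module, since `S^{μ''}` and
`S^μ` are the same submodule of it. -/
def IsAssociatorFamily {n : ℕ} (φ : ∀ μ : Ptn n, specht μ →ₗ[ℂ] specht μ.conj) : Prop :=
  (∀ (μ : Ptn n) (σ : Equiv.Perm (Fin n)) (x : specht μ),
    φ μ (MonoidAlgebra.of ℂ _ σ • x) =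
      ((Equiv.Perm.sign σ : ℤ) : ℂ) • MonoidAlgebra.of ℂ _ σ • φ μ x) ∧
  ∀ (μ : Ptn n) (x : specht μ),
    ((φ μ.conj (φ μ x) : specht μ.conj.conj) : TabloidModule n) = (x : TabloidModule n)

/-- The eigenspace `{x ∈ S^μ | f x = ε x}` of a map `f : S^μ → S^{μ'}`, used for `μ = μ'`; for
`f = φ^μ` and `ε = 1, -1` these are `S^{μ+}` and `S^{μ-}`. -/
def spechtEigen {n : ℕ} {μ : Ptn n} (f : specht μ →ₗ[ℂ] specht μ.conj) (ε : ℂ) :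
    Submodule ℂ (specht μ) where
  carrier := {x | (f x : TabloidModule n) = ε • (x : TabloidModule n)}
  add_mem' {x y} hx hy := by
    simp only [Set.mem_ofPred_eq] at hx hy ⊢
    simp [hx, hy]
  zero_mem' := by simp
  smul_mem' c x hx := by
    simp only [Set.mem_ofPred_eq] at hx ⊢
    simp [hx, smul_comm c ε]

end

noncomputable section

open Equiv (Perm)

set_option maxSynthPendingDepth 3
set_option linter.unusedSectionVars false

/-! ### Signs and the permutation module -/

/-! A $\mathbb{Z}/2$-grading compatible with $\mathbb{C}S_n$ on a module $V$ is the same thing as an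
involution $\delta$ of $V$ with $\delta\sigma=\operatorname{sgn}(\sigma)\sigma\delta$: the graded
parts are its $\pm1$ eigenspaces (`parityMap`, `ofInvolution`), and subsupermodules are the
$\delta$-stable submodules. The problem is thus to classify simple modules together with their
twists by the sign.

Ordinary input. The column antisymmetrizer of a tableau $T$ maps $S^\mu$ onto the line of the
polytabloid of $T$, so Maschke's theorem makes $S^\mu$ simple. It kills $S^\nu$ unless $\mu$
dominates $\nu$, so distinct Specht modules are not isomorphic. Cycle types embed the conjugacy
classes into the partitions, so orthogonality of characters leaves no room for another simple module
(`exists_specht_equiv`). Sending the tabloid of $T$ to the polytabloid of its transpose gives a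
nonzero sign-twisted map $S^\mu\to S^{\mu'}$; Schur's lemma and a square root normalize it to
$\phi^\mu$.

Supermodules. If $\mu\ne\mu'$, the involution exchanging $S^\mu$ and $S^{\mu'}$ through $\phi$
preserves no proper nonzero submodule, which gives Type Q; if $\mu=\mu'$, $\phi^\mu$ itself is the
involution on the simple module $S^\mu$, which gives Type M. A simple supermodule $V$ contains some
$S^\kappa$, and $\delta$ carries it to a copy of $S^{\kappa'}$, so $V$ receives a nonzero map $f$
from $S^\mu$ with $\mu$ a chosen representative. Combining $f$ with $\delta f\phi$ produces a
nonzero map $W^\mu\to V$ compatible with the parities, and graded Schur makes it bijective.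
Conversely, a homogeneous isomorphism preserves simple constituents up to conjugation, so distinct
representatives stay distinct. -/

/-- The sign of a permutation as a complex number. -/
def complexSign {n : ℕ} : Perm (Fin n) →* ℂ :=
  (Int.castRingHom ℂ : ℤ →* ℂ).comp ((Units.coeHom ℤ).comp Perm.sign)

theorem complexSign_apply {n : ℕ} (σ : Perm (Fin n)) :
    complexSign σ = ((Perm.sign σ : ℤ) : ℂ) := rfl

theorem complexSign_mul_self {n : ℕ} (σ : Perm (Fin n)) : complexSign σ * complexSign σ = 1 := by
  rcases Int.units_eq_one_or (Perm.sign σ) with h | h <;> simp [complexSign_apply, h]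

theorem complexSign_inv {n : ℕ} (σ : Perm (Fin n)) : complexSign σ⁻¹ = complexSign σ := by
  simp [complexSign_apply]

/-- The basis vector of the permutation module given by a row assignment. -/
def tabloidBasis {n : ℕ} (f : RowAssignment n) : TabloidModule n :=
  (Representation.asModuleEquiv _).symm (MonoidAlgebra.single f (1 : ℂ))

/-- The coefficient of a row assignment in an element of the permutation module. -/
def tabloidCoeff {n : ℕ} (f : RowAssignment n) : TabloidModule n →ₗ[ℂ] ℂ :=
  (Finsupp.lapply f ∘ₗ (MonoidAlgebra.coeffLinearEquiv ℂ).toLinearMap) ∘ₗ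
    (Representation.asModuleEquiv _).toLinearMap

theorem tabloidCoeff_basis_self {n : ℕ} (f : RowAssignment n) :
    tabloidCoeff f (tabloidBasis f) = 1 := by
  simp [tabloidCoeff, tabloidBasis]

theorem tabloidCoeff_basis_of_ne {n : ℕ} {f g : RowAssignment n} (h : g ≠ f) :
    tabloidCoeff f (tabloidBasis g) = 0 := by
  simp [tabloidCoeff, tabloidBasis, h]

theorem of_smul_tabloidBasis {n : ℕ} (σ : Perm (Fin n)) (f : RowAssignment n) :
    MonoidAlgebra.of ℂ _ σ • tabloidBasis f = tabloidBasis (σ • f) := by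
  rw [tabloidBasis, ← Representation.asModuleEquiv_symm_map_rho,
    Representation.ofMulAction_single, tabloidBasis]

theorem RowAssignment.smul_apply {n : ℕ} (σ : Perm (Fin n)) (f : RowAssignment n) (k : Fin n) :
    (σ • f) k = f (σ⁻¹ k) := rfl

/-- The linear map on the permutation module with prescribed values on the basis. -/
def tabloidLift {n : ℕ} {V : Type*} [AddCommGroup V] [Module ℂ V] (F : RowAssignment n → V) :
    TabloidModule n →ₗ[ℂ] V :=
  (Finsupp.linearCombination ℂ F ∘ₗ (MonoidAlgebra.coeffLinearEquiv ℂ).toLinearMap) ∘ₗ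
    (Representation.asModuleEquiv _).toLinearMap

theorem tabloidLift_basis {n : ℕ} {V : Type*} [AddCommGroup V] [Module ℂ V]
    (F : RowAssignment n → V) (f : RowAssignment n) : tabloidLift F (tabloidBasis f) = F f := by
  simp [tabloidLift, tabloidBasis]

theorem span_tabloidBasis (n : ℕ) :
    Submodule.span ℂ (Set.range (tabloidBasis (n := n))) = ⊤ := by
  rw [eq_top_iff]
  intro x _
  obtain ⟨y, rfl⟩ := (Representation.asModuleEquiv _).symm.surjective x
  induction y using MonoidAlgebra.induction_linear with
  | zero => simp
  | add x y hx hy => simpa using Submodule.add_mem _ (hx trivial) (hy trivial)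
  | single f c =>
    have : (MonoidAlgebra.single f c) = c • MonoidAlgebra.single f (1 : ℂ) := by
      simp [MonoidAlgebra.smul_single]
    rw [this, map_smul]
    exact Submodule.smul_mem _ _ (Submodule.subset_span ⟨f, rfl⟩)

theorem tabloidModule_ext {n : ℕ} {V : Type*} [AddCommGroup V] [Module ℂ V]
    {F G : TabloidModule n →ₗ[ℂ] V} (h : ∀ f, F (tabloidBasis f) = G (tabloidBasis f)) : F = G :=
  LinearMap.ext_on_range (span_tabloidBasis n) h

/-! ### Signed and unsigned sums over the stabilizer of a labelling -/

/-- The signed sum of the permutations which preserve the labelling `c` of the letters. -/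
def antisymmetrizer {n : ℕ} (c : Fin n → ℕ) : GroupAlgSn n :=
  ∑ π : Perm (Fin n) with ∀ k, c (π k) = c k, MonoidAlgebra.single π ((Perm.sign π : ℤ) : ℂ)

theorem single_eq_smul_of {n : ℕ} (σ : Perm (Fin n)) (r : ℂ) :
    (MonoidAlgebra.single σ r : GroupAlgSn n) = r • MonoidAlgebra.of ℂ _ σ := by
  simp [MonoidAlgebra.of_apply, MonoidAlgebra.smul_single]

theorem antisymmetrizer_eq {n : ℕ} (c : Fin n → ℕ) :
    antisymmetrizer c = ∑ π : Perm (Fin n) with ∀ k, c (π k) = c k,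
      complexSign π • MonoidAlgebra.of ℂ _ π :=
  Finset.sum_congr rfl fun _ _ => single_eq_smul_of _ _

theorem antisymmetrizer_mul_of {n : ℕ} (c : Fin n → ℕ) {σ : Perm (Fin n)}
    (hσ : ∀ k, c (σ k) = c k) :
    antisymmetrizer c * MonoidAlgebra.of ℂ _ σ = complexSign σ • antisymmetrizer c := by
  rw [antisymmetrizer_eq, Finset.sum_mul, Finset.smul_sum]
  refine Finset.sum_equiv (Equiv.mulRight σ) ?_ ?_
  · intro π
    simp only [Finset.mem_filter, Finset.mem_univ, true_and, Equiv.coe_mulRight, Perm.mul_apply]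
    refine ⟨fun h k => by rw [h, hσ], fun h k => ?_⟩
    obtain ⟨k, rfl⟩ := σ.surjective k
    rw [h, hσ]
  · intro π _
    rw [Equiv.coe_mulRight, smul_mul_assoc, ← map_mul, smul_smul, map_mul complexSign,
      mul_left_comm, complexSign_mul_self, mul_one]

/-- Conjugation by $\sigma$ preserves signs and carries the stabilizer of $c$ to that of
$c\circ\sigma^{-1}$. -/
theorem of_mul_antisymmetrizer {n : ℕ} (c : Fin n → ℕ) (σ : Perm (Fin n)) :
    MonoidAlgebra.of ℂ _ σ * antisymmetrizer c =
      antisymmetrizer (c ∘ ⇑σ⁻¹) * MonoidAlgebra.of ℂ _ σ := by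
  rw [antisymmetrizer_eq, antisymmetrizer_eq, Finset.sum_mul, Finset.mul_sum]
  refine Finset.sum_equiv (MulAut.conj σ).toEquiv ?_ ?_
  · intro π
    simp only [Finset.mem_filter, Finset.mem_univ, true_and, MulEquiv.toEquiv_eq_coe,
      EquivLike.coe_coe, MulAut.conj_apply, Function.comp_apply, Perm.mul_apply]
    refine ⟨fun h k => ?_, fun h k => ?_⟩
    · simpa using h (σ⁻¹ k)
    · simpa using h (σ k)
  · intro π _
    have h : complexSign (σ * π * σ⁻¹) = complexSign π := by
      rw [map_mul, map_mul, complexSign_inv, mul_right_comm, complexSign_mul_self, one_mul]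
    simp only [MulEquiv.toEquiv_eq_coe, EquivLike.coe_coe, MulAut.conj_apply, h,
      mul_smul_comm, smul_mul_assoc, ← map_mul, inv_mul_cancel_right]

theorem antisymmetrizer_mul_self {n : ℕ} (c : Fin n → ℕ) :
    antisymmetrizer c * antisymmetrizer c =
      ((Finset.univ.filter fun π : Perm (Fin n) => ∀ k, c (π k) = c k).card : ℂ) •
        antisymmetrizer c := by
  nth_rewrite 2 [antisymmetrizer_eq c]
  rw [Finset.mul_sum, Nat.cast_smul_eq_nsmul, ← Finset.sum_const]
  refine Finset.sum_congr rfl fun π hπ => ?_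
  rw [mul_smul_comm, antisymmetrizer_mul_of c (by simpa using hπ), smul_smul,
    complexSign_mul_self, one_smul]

theorem card_labelStabilizer_ne_zero {n : ℕ} (c : Fin n → ℕ) :
    ((Finset.univ.filter fun π : Perm (Fin n) => ∀ k, c (π k) = c k).card : ℂ) ≠ 0 := by
  rw [Nat.cast_ne_zero]
  exact Finset.card_ne_zero_of_mem (a := 1) (by simp)

theorem antisymmetrizer_smul_tabloidBasis {n : ℕ} (c : Fin n → ℕ) (f : RowAssignment n) :
    antisymmetrizer c • tabloidBasis f =
      ∑ π : Perm (Fin n) with ∀ k, c (π k) = c k, complexSign π • tabloidBasis (π • f) := by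
  rw [antisymmetrizer_eq, Finset.sum_smul]
  refine Finset.sum_congr rfl fun π _ => ?_
  rw [smul_assoc, of_smul_tabloidBasis]

/-- The antisymmetrizer kills a tabloid having two letters in the same row with equal labels. -/
theorem antisymmetrizer_smul_eq_zero {n : ℕ} {c : Fin n → ℕ} {f : RowAssignment n} {a b : Fin n}
    (hab : a ≠ b) (hc : c a = c b) (hf : f a = f b) :
    antisymmetrizer c • tabloidBasis f = 0 := by
  have h1 : ∀ g : Fin n → ℕ, g a = g b → ∀ k, g (Equiv.swap a b k) = g k := by
    intro g hg k
    by_cases hka : k = a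
    · rw [hka, Equiv.swap_apply_left, hg]
    by_cases hkb : k = b
    · rw [hkb, Equiv.swap_apply_right, hg]
    rw [Equiv.swap_apply_of_ne_of_ne hka hkb]
  have h2 : Equiv.swap a b • f = f := by
    funext k
    rw [RowAssignment.smul_apply, Equiv.swap_inv]
    exact h1 f hf k
  -- The transposition of $a$ and $b$ fixes the tabloid, yet absorbing it into the antisymmetrizer
  -- costs a sign.
  have h3 : antisymmetrizer c • tabloidBasis f = -(antisymmetrizer c • tabloidBasis f) := by
    conv_lhs => rw [← h2, ← of_smul_tabloidBasis, ← mul_smul, antisymmetrizer_mul_of c (h1 c hc)]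
    simp [complexSign_apply, Perm.sign_swap hab]
  rw [← add_eq_zero_iff_eq_neg, ← two_smul ℂ] at h3
  exact (smul_eq_zero.1 h3).resolve_left two_ne_zero

/-! ### Tableaux -/

namespace Tableau

variable {n : ℕ} {μ : Ptn n}

/-- The row of each letter of a tableau. -/
def rowOf (T : Tableau μ) : RowAssignment n := fun k => (T k).1.1

/-- The column of each letter of a tableau. -/
def colOf (T : Tableau μ) : Fin n → ℕ := fun k => (T k).1.2

theorem polytabloid_eq (T : Tableau μ) :
    T.polytabloid = antisymmetrizer T.colOf • tabloidBasis T.rowOf := rfl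

theorem eq_of_rowOf_colOf (T : Tableau μ) {a b : Fin n} (hr : T.rowOf a = T.rowOf b)
    (hc : T.colOf a = T.colOf b) : a = b :=
  T.injective (Subtype.ext (Prod.ext hr hc))

theorem exists_tableau (μ : Ptn n) : Nonempty (Tableau μ) :=
  ⟨Fintype.equivOfCardEq (by simpa using μ.2.symm)⟩

theorem eq_one_of_rowOf_colOf (T : Tableau μ) {π : Perm (Fin n)}
    (hr : π • T.rowOf = T.rowOf) (hc : ∀ k, T.colOf (π k) = T.colOf k) : π = 1 := by
  ext1 k
  refine T.eq_of_rowOf_colOf ?_ (hc k)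
  have := congrFun hr (π k)
  rw [RowAssignment.smul_apply] at this
  simpa using this.symm

/-- A column permutation that also fixes the tabloid preserves rows and columns, so only the
identity term contributes. -/
theorem coeff_polytabloid (T : Tableau μ) : tabloidCoeff T.rowOf T.polytabloid = 1 := by
  rw [polytabloid_eq, antisymmetrizer_smul_tabloidBasis, map_sum,
    Finset.sum_eq_single_of_mem (1 : Perm (Fin n)) (by simp)]
  · simp [tabloidCoeff_basis_self]
  · intro π hπ h1
    rw [map_smul, tabloidCoeff_basis_of_ne, smul_zero]
    exact fun h => h1 (T.eq_one_of_rowOf_colOf h (by simpa using hπ))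

theorem polytabloid_ne_zero (T : Tableau μ) : T.polytabloid ≠ 0 := by
  intro h
  have := T.coeff_polytabloid
  rw [h, map_zero] at this
  exact zero_ne_one this

/-- Permutations act on the polytabloids through the tableaux. -/
theorem polytabloid_eq_of_smul (T T' : Tableau μ) :
    T'.polytabloid = MonoidAlgebra.of ℂ _ (T.trans T'.symm : Perm (Fin n)) • T.polytabloid := by
  rw [polytabloid_eq, polytabloid_eq, smul_smul, of_mul_antisymmetrizer, mul_smul,
    of_smul_tabloidBasis]
  have h : ∀ k, T ((T.trans T'.symm : Perm (Fin n))⁻¹ k) = T' k := by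
    intro k
    change T ((T.trans T'.symm).symm k) = T' k
    simp
  congr 2
  · funext k
    exact (congrArg (fun c => c.1.2) (h k)).symm
  · funext k
    exact (congrArg (fun c => c.1.1) (h k)).symm

end Tableau

theorem specht_eq_span_singleton {n : ℕ} {μ : Ptn n} (T : Tableau μ) :
    specht μ = Submodule.span (GroupAlgSn n) {T.polytabloid} := by
  refine le_antisymm (Submodule.span_le.2 ?_) (Submodule.span_mono (by simp))
  rintro _ ⟨T', rfl⟩
  rw [T.polytabloid_eq_of_smul T']
  exact Submodule.smul_mem _ _ (Submodule.mem_span_singleton_self _)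

theorem polytabloid_mem_specht {n : ℕ} {μ : Ptn n} (T : Tableau μ) : T.polytabloid ∈ specht μ :=
  Submodule.subset_span ⟨T, rfl⟩

/-- A `ℂ`-subspace that is stable under permutations contains the submodule generated by its
elements. -/
theorem mem_of_mem_span_groupAlgebra {n : ℕ} {V : Type*} [AddCommGroup V] [Module ℂ V]
    [Module (GroupAlgSn n) V] [IsScalarTower ℂ (GroupAlgSn n) V] {s : Set V} {P : Submodule ℂ V}
    (hP : ∀ (σ : Perm (Fin n)), ∀ x ∈ P, MonoidAlgebra.of ℂ _ σ • x ∈ P) (hs : s ⊆ P) {x : V}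
    (hx : x ∈ Submodule.span (GroupAlgSn n) s) : x ∈ P := by
  induction hx using Submodule.span_induction with
  | mem x h => exact hs h
  | zero => exact P.zero_mem
  | add x y _ _ hx hy => exact P.add_mem hx hy
  | smul a x _ hx =>
    induction a using MonoidAlgebra.induction_on with
    | of σ => exact hP σ x hx
    | add a b ha hb => rw [add_smul]; exact P.add_mem ha hb
    | smul r a ha => rw [smul_assoc]; exact P.smul_mem r ha

/-- The elements of a Specht module are combinations of tabloids of the same shape. -/
theorem mem_span_tabloids_of_mem_specht {n : ℕ} {μ : Ptn n} {x : TabloidModule n}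
    (hx : x ∈ specht μ) :
    x ∈ Submodule.span ℂ (Set.range fun T : Tableau μ => tabloidBasis T.rowOf) := by
  have hP : ∀ (σ : Perm (Fin n)),
      ∀ x ∈ Submodule.span ℂ (Set.range fun T : Tableau μ => tabloidBasis T.rowOf),
      MonoidAlgebra.of ℂ _ σ • x ∈
        Submodule.span ℂ (Set.range fun T : Tableau μ => tabloidBasis T.rowOf) := by
    intro σ x hx
    induction hx using Submodule.span_induction with
    | mem x h =>
      obtain ⟨T, rfl⟩ := h
      refine Submodule.subset_span ⟨(σ⁻¹ : Perm (Fin n)).trans T, ?_⟩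
      simp only [of_smul_tabloidBasis]
      rfl
    | zero => simp
    | add x y _ _ hx hy => rw [smul_add]; exact Submodule.add_mem _ hx hy
    | smul c x _ hx =>
      rw [smul_comm]
      exact Submodule.smul_mem _ _ hx
  refine mem_of_mem_span_groupAlgebra hP ?_ hx
  rintro _ ⟨T, rfl⟩
  rw [T.polytabloid_eq, antisymmetrizer_smul_tabloidBasis]
  refine Submodule.sum_mem _ fun π _ => Submodule.smul_mem _ _ ?_
  rw [← of_smul_tabloidBasis]
  exact hP π _ (Submodule.subset_span ⟨T, rfl⟩)

/-! ### Dominance -/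

namespace Tableau

variable {n : ℕ} {μ ν : Ptn n}

theorem card_filter_cells (T : Tableau μ) (p : ℕ × ℕ → Prop) [DecidablePred p] :
    (Finset.univ.filter fun k => p (T k).1).card = (μ.1.cells.filter p).card := by
  refine Finset.card_bij (fun k _ => (T k).1) ?_ ?_ ?_
  · intro k hk
    simpa using hk
  · intro a _ b _ h
    exact T.injective (Subtype.ext h)
  · intro b hb
    rw [Finset.mem_filter] at hb
    exact ⟨T.symm ⟨b, hb.1⟩, by simpa using hb.2, by simp⟩

/-- Among the letters of one column of `T`, at most as many lie in the first `r` rows of a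
column-injective row assignment as do in `T`. -/
theorem card_column_le (T : Tableau μ) {f : Fin n → ℕ}
    (hf : ∀ a b, T.colOf a = T.colOf b → f a = f b → a = b) (j r : ℕ) :
    (Finset.univ.filter fun k => T.colOf k = j ∧ f k < r).card ≤
      (Finset.univ.filter fun k => T.colOf k = j ∧ (T k).1.1 < r).card := by
  -- If column $j$ has at least $r$ cells, $T$ realizes every row below $r$, while injectivity of
  -- $f$ bounds the left side by $r$. Otherwise the right side already counts the whole column.
  rcases le_total r (μ.1.colLen j) with h | h
  · have h1 : (Finset.univ.filter fun k => T.colOf k = j ∧ f k < r).card ≤ (Finset.range r).card :=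
      Finset.card_le_card_of_injOn f (by intro k; simp) (by
        intro a ha b hb hab
        simp only [Finset.coe_filter, Finset.mem_univ, true_and, Set.mem_ofPred_eq] at ha hb
        exact hf a b (ha.1.trans hb.1.symm) hab)
    refine h1.trans (Finset.card_le_card_of_surjOn (fun k => (T k).1.1) ?_)
    intro i hi
    have hi' : i < r := by simpa using hi
    have hmem : (i, j) ∈ μ.1.cells := by
      rw [YoungDiagram.mem_cells, YoungDiagram.mem_iff_lt_colLen]
      omega
    exact ⟨T.symm ⟨(i, j), hmem⟩, Finset.mem_coe.2 (Finset.mem_filter.2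
      ⟨Finset.mem_univ _, by simp [colOf], by simpa using hi'⟩), by simp⟩
  · have h2 : (Finset.univ.filter fun k => T.colOf k = j ∧ (T k).1.1 < r) =
        Finset.univ.filter fun k => T.colOf k = j := by
      refine Finset.filter_congr fun k _ => and_iff_left_of_imp fun hk => ?_
      have := (T k).2
      rw [YoungDiagram.mem_cells, YoungDiagram.mem_iff_lt_colLen] at this
      change (T k).1.2 = j at hk
      rw [hk] at this
      exact lt_of_lt_of_le this h
    rw [h2]
    exact Finset.card_le_card (Finset.monotone_filter_right _ fun k _ hk => hk.1)

theorem card_filter_eq_sum_columns (T : Tableau μ) (p : Fin n → Prop) [DecidablePred p] :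
    (Finset.univ.filter p).card =
      ∑ j ∈ Finset.univ.image T.colOf,
        (Finset.univ.filter fun k => T.colOf k = j ∧ p k).card := by
  rw [Finset.card_eq_sum_card_fiberwise (f := T.colOf) (t := Finset.univ.image T.colOf)
    (fun k _ => by simp)]
  refine Finset.sum_congr rfl fun j _ => ?_
  rw [Finset.filter_filter]
  congr 1
  ext k
  simp [and_comm]

/-- A column-injective row assignment is dominated by the shape of the tableau. -/
theorem card_rows_le (T : Tableau μ) {f : Fin n → ℕ}
    (hf : ∀ a b, T.colOf a = T.colOf b → f a = f b → a = b) (r : ℕ) :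
    (Finset.univ.filter fun k => f k < r).card ≤
      (Finset.univ.filter fun k => (T k).1.1 < r).card := by
  rw [T.card_filter_eq_sum_columns, T.card_filter_eq_sum_columns fun k => (T k).1.1 < r]
  exact Finset.sum_le_sum fun j _ => T.card_column_le hf j r

/-- A tabloid of the same shape that is injective on the columns of `T` differs from the tabloid
of `T` by a column permutation. -/
theorem exists_column_permutation (T T' : Tableau μ)
    (hf : ∀ a b, T.colOf a = T.colOf b → T'.rowOf a = T'.rowOf b → a = b) :
    ∃ π : Perm (Fin n), (∀ k, T.colOf (π k) = T.colOf k) ∧ T'.rowOf = π • T.rowOf := by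
  -- Both tableaux have shape $\mu$, so the totals over all columns agree and each columnwise
  -- inequality is an equality. With $r$ the length of the column of $k$, every letter of that
  -- column must have `T'`-row below $r$.
  have hlt : ∀ k, (T' k).1.1 < μ.1.colLen (T.colOf k) := by
    intro k
    set r := μ.1.colLen (T.colOf k) with hr
    have hsum : (Finset.univ.filter fun k => (T' k).1.1 < r).card =
        (Finset.univ.filter fun k => (T k).1.1 < r).card :=
      (T'.card_filter_cells fun c => c.1 < r).trans (T.card_filter_cells fun c => c.1 < r).symm
    rw [T.card_filter_eq_sum_columns, T.card_filter_eq_sum_columns fun k => (T k).1.1 < r] at hsum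
    have heq := (Finset.sum_eq_sum_iff_of_le fun j _ => T.card_column_le hf j r).1 hsum
      (T.colOf k) (by simp)
    have hall : (Finset.univ.filter fun l => T.colOf l = T.colOf k ∧ (T l).1.1 < r) =
        Finset.univ.filter fun l => T.colOf l = T.colOf k := by
      refine Finset.filter_congr fun l _ => and_iff_left_of_imp fun hl => ?_
      have := (T l).2
      rw [YoungDiagram.mem_cells, YoungDiagram.mem_iff_lt_colLen] at this
      rw [hr, ← hl]
      exact this
    rw [hall] at heq
    have hsub := Finset.eq_of_subset_of_card_le
      (Finset.monotone_filter_right Finset.univ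
        (p := fun l => T.colOf l = T.colOf k ∧ (T' l).1.1 < r)
        (q := fun l => T.colOf l = T.colOf k) fun l _ hl => hl.1) heq.ge
    have hk : k ∈ Finset.univ.filter fun l => T.colOf l = T.colOf k ∧ (T' l).1.1 < r := by
      rw [hsub]; simp
    exact (Finset.mem_filter.1 hk).2.2
  -- The letter that `T` places in the column of $k$ and in the row that `T'` gives to $k$; the
  -- inverse of this permutation is the one sought.
  let g : Fin n → Fin n := fun k => T.symm ⟨((T' k).1.1, T.colOf k), by
    rw [YoungDiagram.mem_cells, YoungDiagram.mem_iff_lt_colLen]; exact hlt k⟩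
  have hg : ∀ k, (T (g k)).1 = ((T' k).1.1, T.colOf k) := fun k => by simp [g]
  have hginj : Function.Injective g := by
    intro a b hab
    have h := (hg a).symm.trans ((congrArg (fun k => (T k).1) hab).trans (hg b))
    exact hf a b (Prod.ext_iff.1 h).2 (Prod.ext_iff.1 h).1
  let σ : Perm (Fin n) := Equiv.ofBijective g (Finite.injective_iff_bijective.1 hginj)
  have hcol : ∀ k, T.colOf (σ k) = T.colOf k := fun k => (Prod.ext_iff.1 (hg k)).2
  refine ⟨σ⁻¹, fun k => ?_, ?_⟩
  · rw [← hcol]; simp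
  · funext k
    rw [RowAssignment.smul_apply, inv_inv]
    exact (Prod.ext_iff.1 (hg k)).1.symm

/-- A tabloid of shape $\mu$ either has two letters sharing both a row and a column of $T$, and is
killed, or differs from that of $T$ by a column permutation, which yields the polytabloid up to
sign. -/
theorem antisymmetrizer_smul_mem_span (T : Tableau μ) {x : TabloidModule n} (hx : x ∈ specht μ) :
    ∃ c : ℂ, antisymmetrizer T.colOf • x = c • T.polytabloid := by
  have h := mem_span_tabloids_of_mem_specht hx
  clear hx
  induction h using Submodule.span_induction with
  | mem x h =>
    obtain ⟨T', rfl⟩ := h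
    by_cases hf : ∀ a b, T.colOf a = T.colOf b → T'.rowOf a = T'.rowOf b → a = b
    · obtain ⟨π, hπ, h⟩ := T.exists_column_permutation T' hf
      refine ⟨complexSign π, ?_⟩
      simp only [h]
      rw [← of_smul_tabloidBasis, smul_smul, antisymmetrizer_mul_of _ hπ, smul_assoc,
        ← polytabloid_eq]
    · push Not at hf
      obtain ⟨a, b, hc, hr, hab⟩ := hf
      exact ⟨0, by simp only [antisymmetrizer_smul_eq_zero hab hc hr, zero_smul]⟩
  | zero => exact ⟨0, by simp⟩
  | add x y _ _ hx hy =>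
    obtain ⟨a, ha⟩ := hx
    obtain ⟨b, hb⟩ := hy
    exact ⟨a + b, by rw [smul_add, ha, hb, add_smul]⟩
  | smul c x _ hx =>
    obtain ⟨a, ha⟩ := hx
    exact ⟨c * a, by rw [smul_comm, ha, mul_smul]⟩

theorem antisymmetrizer_smul_polytabloid (T : Tableau μ) :
    antisymmetrizer T.colOf • T.polytabloid =
      ((Finset.univ.filter fun π : Perm (Fin n) => ∀ k, T.colOf (π k) = T.colOf k).card : ℂ) •
        T.polytabloid := by
  rw [polytabloid_eq, smul_smul, antisymmetrizer_mul_self, smul_assoc]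

/-- A tabloid of shape $\nu$ that survives must be injective on the columns of $T$, which forces the
dominance inequality. If the inequality fails for some $r$, all tabloids spanning $S^\nu$ are
killed. -/
theorem card_rows_le_of_smul_ne_zero (T : Tableau μ) {x : TabloidModule n} (hx : x ∈ specht ν)
    (h : antisymmetrizer T.colOf • x ≠ 0) (r : ℕ) :
    (ν.1.cells.filter fun c => c.1 < r).card ≤ (μ.1.cells.filter fun c => c.1 < r).card := by
  by_contra hlt
  refine h ?_
  clear h
  have h := mem_span_tabloids_of_mem_specht hx
  clear hx
  induction h using Submodule.span_induction with
  | mem x h =>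
    obtain ⟨T', rfl⟩ := h
    by_cases hf : ∀ a b, T.colOf a = T.colOf b → T'.rowOf a = T'.rowOf b → a = b
    · refine absurd ?_ hlt
      rw [← T.card_filter_cells, ← T'.card_filter_cells]
      exact T.card_rows_le hf r
    · push Not at hf
      obtain ⟨a, b, hc, hr, hab⟩ := hf
      exact antisymmetrizer_smul_eq_zero hab hc hr
  | zero => simp
  | add x y _ _ hx hy => rw [smul_add, hx, hy, add_zero]
  | smul c x _ hx => rw [smul_comm, hx, smul_zero]

end Tableau

/-- Differences of consecutive counts recover the row lengths, which makes dominance antisymmetric.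
-/
theorem YoungDiagram.eq_of_card_rows_eq {μ ν : YoungDiagram}
    (h : ∀ r, (μ.cells.filter fun c => c.1 < r).card = (ν.cells.filter fun c => c.1 < r).card) :
    μ = ν := by
  have key : ∀ (κ : YoungDiagram) r, (κ.cells.filter fun c => c.1 < r + 1).card =
      (κ.cells.filter fun c => c.1 < r).card + κ.rowLen r := by
    intro κ r
    rw [YoungDiagram.rowLen_eq_card, YoungDiagram.row, ← Finset.card_union_of_disjoint]
    · congr 1
      ext c
      simp only [Finset.mem_filter, Finset.mem_union, Nat.lt_succ_iff_lt_or_eq]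
      tauto
    · rw [Finset.disjoint_left]
      intro c h1 h2
      simp only [Finset.mem_filter] at h1 h2
      omega
  have hrow : ∀ r, μ.rowLen r = ν.rowLen r := by
    intro r
    have h1 := key μ r
    have h2 := key ν r
    rw [h, h] at h1
    omega
  ext ⟨i, j⟩
  simp only [YoungDiagram.mem_cells]
  rw [YoungDiagram.mem_iff_lt_rowLen, YoungDiagram.mem_iff_lt_rowLen, hrow]

/-! ### Specht modules are simple and pairwise non-isomorphic -/

/-- A cyclic module with complemented submodules is simple if some element of the algebra maps it
to the line spanned by the generator and scales the generator by a nonzero factor. -/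
theorem isSimpleModule_of_cyclic {A V : Type*} [Ring A] [Algebra ℂ A] [AddCommGroup V] [Module ℂ V]
    [Module A V] [IsScalarTower ℂ A V] [IsSemisimpleModule A V] {e : V} (he : e ≠ 0)
    (hgen : Submodule.span A {e} = ⊤) {κ : A} (hκ : ∀ x : V, ∃ c : ℂ, κ • x = c • e)
    (hκe : ∃ c : ℂ, c ≠ 0 ∧ κ • e = c • e) : IsSimpleModule A V := by
  have hmem : ∀ N : Submodule A V, e ∈ N → N = ⊤ := fun N hN => by
    rw [eq_top_iff, ← hgen, Submodule.span_le]
    simpa using hN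
  have hsmul : ∀ (N : Submodule A V) (c : ℂ), c ≠ 0 → c • e ∈ N → e ∈ N := fun N c hc h => by
    have := N.smul_mem (algebraMap ℂ A c⁻¹) h
    rwa [algebraMap_smul, inv_smul_smul₀ hc] at this
  have : Nontrivial V := ⟨e, 0, he⟩
  rw [isSimpleModule_iff]
  refine ⟨fun N => ?_⟩
  obtain ⟨N', hN'⟩ := exists_isCompl N
  obtain ⟨x, hx, y, hy, hxy⟩ := Submodule.mem_sup.1
    (show e ∈ N ⊔ N' by rw [hN'.sup_eq_top]; trivial)
  -- Since $\kappa e\ne0$ and $e=x+y$, at least one of $\kappa x$, $\kappa y$ is a nonzero multiple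
  -- of $e$; the summand containing it is everything.
  obtain ⟨a, ha⟩ := hκ x
  obtain ⟨b, hb⟩ := hκ y
  obtain ⟨c, hc, hce⟩ := hκe
  by_cases ha0 : a = 0
  · by_cases hb0 : b = 0
    · refine absurd ?_ (smul_ne_zero hc he)
      rw [← hce, ← hxy, smul_add, ha, hb, ha0, hb0, zero_smul, add_zero]
    · left
      have := hmem N' (hsmul N' b hb0 (hb ▸ N'.smul_mem κ hy))
      rw [this] at hN'
      exact eq_bot_of_isCompl_top hN'
  · right
    exact hmem N (hsmul N a ha0 (ha ▸ N.smul_mem κ hx))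

/-- The column antisymmetrizer plays the role of `κ` in `isSimpleModule_of_cyclic`; Maschke's
theorem supplies the complements. -/
instance specht_isSimpleModule {n : ℕ} (μ : Ptn n) : IsSimpleModule (GroupAlgSn n) (specht μ) := by
  obtain ⟨T⟩ := Tableau.exists_tableau μ
  refine isSimpleModule_of_cyclic (e := (⟨T.polytabloid, polytabloid_mem_specht T⟩ : specht μ))
    (κ := antisymmetrizer T.colOf) ?_ ?_ ?_ ⟨_, card_labelStabilizer_ne_zero T.colOf, ?_⟩
  · exact fun h => T.polytabloid_ne_zero (congrArg Subtype.val h)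
  · rw [eq_top_iff]
    rintro ⟨x, hx⟩ -
    rw [specht_eq_span_singleton T, Submodule.mem_span_singleton] at hx
    obtain ⟨a, rfl⟩ := hx
    exact Submodule.mem_span_singleton.2 ⟨a, rfl⟩
  · rintro ⟨x, hx⟩
    obtain ⟨c, hc⟩ := T.antisymmetrizer_smul_mem_span hx
    exact ⟨c, Subtype.ext hc⟩
  · exact Subtype.ext T.antisymmetrizer_smul_polytabloid

/-- The antisymmetrizer of a $\mu$-tableau does not annihilate $S^\mu$, hence not the isomorphic
$S^\nu$ either. -/
theorem card_rows_le_of_specht_equiv {n : ℕ} {μ ν : Ptn n}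
    (e : specht μ ≃ₗ[GroupAlgSn n] specht ν) (r : ℕ) :
    (ν.1.cells.filter fun c => c.1 < r).card ≤ (μ.1.cells.filter fun c => c.1 < r).card := by
  obtain ⟨T⟩ := Tableau.exists_tableau μ
  let p : specht μ := ⟨T.polytabloid, polytabloid_mem_specht T⟩
  refine T.card_rows_le_of_smul_ne_zero (e p).2 ?_ r
  have h1 : antisymmetrizer T.colOf • p ≠ 0 := by
    intro h
    have := (T.antisymmetrizer_smul_polytabloid).symm.trans (congrArg Subtype.val h)
    exact smul_ne_zero (card_labelStabilizer_ne_zero T.colOf) T.polytabloid_ne_zero this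
  rw [← Submodule.coe_smul, ← map_smul, Ne, Submodule.coe_eq_zero, e.map_eq_zero_iff]
  exact h1

theorem eq_of_specht_equiv {n : ℕ} {μ ν : Ptn n}
    (h : Nonempty (specht μ ≃ₗ[GroupAlgSn n] specht ν)) : μ = ν := by
  obtain ⟨e⟩ := h
  exact Subtype.ext (YoungDiagram.eq_of_card_rows_eq fun r =>
    le_antisymm (card_rows_le_of_specht_equiv e.symm r) (card_rows_le_of_specht_equiv e r))

/-! ### Maps twisted by the sign -/

section Twisted

variable {n : ℕ} {V : Type*} [AddCommGroup V] [Module ℂ V] [Module (GroupAlgSn n) V]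
  [IsScalarTower ℂ (GroupAlgSn n) V] {W : Type*} [AddCommGroup W] [Module ℂ W]
  [Module (GroupAlgSn n) W] [IsScalarTower ℂ (GroupAlgSn n) W]
  {X : Type*} [AddCommGroup X] [Module ℂ X] [Module (GroupAlgSn n) X]

/-- A linear map that intertwines the actions of `S_n` up to the sign. -/
def IsSignTwisted (n : ℕ) {V W : Type*} [AddCommGroup V] [Module ℂ V] [Module (GroupAlgSn n) V]
    [AddCommGroup W] [Module ℂ W] [Module (GroupAlgSn n) W] (F : V →ₗ[ℂ] W) : Prop :=
  ∀ (σ : Perm (Fin n)) (x : V),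
    F (MonoidAlgebra.of ℂ _ σ • x) = complexSign σ • MonoidAlgebra.of ℂ _ σ • F x

theorem IsSignTwisted.comp [IsScalarTower ℂ (GroupAlgSn n) X]
    {F : V →ₗ[ℂ] W} {G : W →ₗ[ℂ] X} (hF : IsSignTwisted n F)
    (hG : IsSignTwisted n G) (σ : Perm (Fin n)) (x : V) :
    G (F (MonoidAlgebra.of ℂ _ σ • x)) = MonoidAlgebra.of ℂ _ σ • G (F x) := by
  rw [hF, map_smul, hG, smul_smul, complexSign_mul_self, one_smul]

/-- A linear map commuting with permutations, as a linear map over the group algebra. -/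
def linearOfEquivariant (F : V →ₗ[ℂ] W) (hF : ∀ (σ : Perm (Fin n)) (x : V),
    F (MonoidAlgebra.of ℂ _ σ • x) = MonoidAlgebra.of ℂ _ σ • F x) : V →ₗ[GroupAlgSn n] W :=
  MonoidAlgebra.equivariantOfLinearOfComm F hF

/-- A `ℂ`-subspace stable under permutations, as a submodule over the group algebra. -/
def submoduleOfStable (P : Submodule ℂ V)
    (hP : ∀ (σ : Perm (Fin n)), ∀ x ∈ P, MonoidAlgebra.of ℂ _ σ • x ∈ P) :
    Submodule (GroupAlgSn n) V where
  carrier := P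
  add_mem' := P.add_mem
  zero_mem' := P.zero_mem
  smul_mem' a x hx := mem_of_mem_span_groupAlgebra hP (s := {x}) (by simpa using hx)
    (Submodule.smul_mem _ a (Submodule.mem_span_singleton_self x))

/-- The twist only rescales, so the kernel is still a submodule and Schur's argument applies. -/
theorem IsSignTwisted.injective [IsSimpleModule (GroupAlgSn n) V] {F : V →ₗ[ℂ] W}
    (hF : IsSignTwisted n F) (h0 : F ≠ 0) : Function.Injective F := by
  have hker : ∀ (σ : Perm (Fin n)), ∀ x ∈ LinearMap.ker F,
      MonoidAlgebra.of ℂ _ σ • x ∈ LinearMap.ker F := by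
    intro σ x hx
    rw [LinearMap.mem_ker] at hx ⊢
    rw [hF, hx, smul_zero, smul_zero]
  rcases eq_bot_or_eq_top (submoduleOfStable (LinearMap.ker F) hker) with h | h
  · rw [injective_iff_map_eq_zero]
    intro x hx
    have : x ∈ submoduleOfStable (LinearMap.ker F) hker := hx
    rwa [h] at this
  · refine absurd (LinearMap.ext fun x => ?_) h0
    have : x ∈ submoduleOfStable (LinearMap.ker F) hker := by rw [h]; trivial
    exact this

end Twisted

/-! ### The associators -/

theorem Ptn.conj_conj {n : ℕ} (μ : Ptn n) : μ.conj.conj = μ :=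
  Subtype.ext (YoungDiagram.transpose_transpose μ.1)

namespace Tableau

variable {n : ℕ} {μ : Ptn n}

/-- The transposed tableau. -/
def transpose (T : Tableau μ) : Tableau μ.conj :=
  T.trans ((Equiv.prodComm ℕ ℕ).subtypeEquiv fun c => by
    rw [YoungDiagram.mem_cells, YoungDiagram.mem_cells]
    exact (YoungDiagram.mem_transpose (μ := μ.1) (c := c.swap)).symm)

open Classical in
/-- The sign-twisted map sending the tabloid of `T` to the polytabloid of its transpose. -/
def associator (T : Tableau μ) : TabloidModule n →ₗ[ℂ] TabloidModule n :=
  -- Summing over all $\sigma$ carrying the tabloid of $T$ to $f$ avoids choosing one of them; the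
  -- sum is empty when $f$ is not in the orbit.
  tabloidLift fun f => ∑ σ : Perm (Fin n) with σ • T.rowOf = f,
    complexSign σ • tabloidBasis (σ • T.transpose.rowOf)

theorem associator_isSignTwisted (T : Tableau μ) : IsSignTwisted n T.associator := by
  intro τ x
  have key : T.associator ∘ₗ Algebra.lsmul ℂ ℂ _ (MonoidAlgebra.of ℂ _ τ) =
      complexSign τ • Algebra.lsmul ℂ ℂ _ (MonoidAlgebra.of ℂ _ τ) ∘ₗ T.associator := by
    refine tabloidModule_ext fun f => ?_
    simp only [LinearMap.comp_apply, LinearMap.smul_apply, Algebra.lsmul_coe]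
    rw [of_smul_tabloidBasis, associator, tabloidLift_basis, tabloidLift_basis, Finset.smul_sum,
      Finset.smul_sum]
    symm
    refine Finset.sum_equiv (Equiv.mulLeft τ) (fun σ => ?_) (fun σ _ => ?_)
    · simp [mul_smul]
    · rw [smul_comm (MonoidAlgebra.of ℂ _ τ), of_smul_tabloidBasis, smul_smul, ← mul_smul,
        ← map_mul]
      rfl
  exact LinearMap.congr_fun key x

theorem smul_rowOf_eq_iff (T : Tableau μ) (σ : Perm (Fin n)) :
    σ • T.rowOf = T.rowOf ↔ ∀ k, T.rowOf (σ k) = T.rowOf k := by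
  constructor
  · intro h k
    have := congrFun h (σ k)
    rw [RowAssignment.smul_apply] at this
    simpa using this.symm
  · intro h
    funext k
    rw [RowAssignment.smul_apply, ← h]
    simp

/-- The row stabilizer of $T$ is the column stabilizer of its transpose. -/
theorem associator_tabloidBasis (T : Tableau μ) :
    T.associator (tabloidBasis T.rowOf) = T.transpose.polytabloid := by
  rw [polytabloid_eq, antisymmetrizer_smul_tabloidBasis, associator, tabloidLift_basis]
  refine Finset.sum_congr ?_ fun _ _ => rfl
  ext σ
  simp only [Finset.mem_filter, T.smul_rowOf_eq_iff]
  rfl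

/-- The signs of the column antisymmetrizer cancel against the twist and leave an unsigned sum. -/
theorem associator_polytabloid (T : Tableau μ) :
    T.associator T.polytabloid = ∑ π : Perm (Fin n) with ∀ k, T.colOf (π k) = T.colOf k,
      MonoidAlgebra.of ℂ _ π • T.transpose.polytabloid := by
  rw [polytabloid_eq, antisymmetrizer_smul_tabloidBasis, map_sum]
  refine Finset.sum_congr rfl fun π _ => ?_
  rw [map_smul, ← of_smul_tabloidBasis, T.associator_isSignTwisted, smul_smul,
    complexSign_mul_self, one_smul, associator_tabloidBasis]

theorem tabloidCoeff_of_smul (σ : Perm (Fin n)) (f : RowAssignment n) (x : TabloidModule n) :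
    tabloidCoeff (σ • f) (MonoidAlgebra.of ℂ _ σ • x) = tabloidCoeff f x := by
  have key : tabloidCoeff (σ • f) ∘ₗ Algebra.lsmul ℂ ℂ _ (MonoidAlgebra.of ℂ _ σ) =
      tabloidCoeff f := by
    refine tabloidModule_ext fun g => ?_
    simp only [LinearMap.comp_apply, Algebra.lsmul_coe]
    rw [of_smul_tabloidBasis]
    by_cases h : g = f
    · rw [h, tabloidCoeff_basis_self, tabloidCoeff_basis_self]
    · rw [tabloidCoeff_basis_of_ne h, tabloidCoeff_basis_of_ne (by simpa using h)]
  exact LinearMap.congr_fun key x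

/-- Column permutations of $T$ are row permutations of the transpose, so they fix its tabloid. Every
summand therefore has coefficient $1$ there, and nothing cancels. -/
theorem associator_polytabloid_ne_zero (T : Tableau μ) : T.associator T.polytabloid ≠ 0 := by
  intro h
  have h1 : tabloidCoeff T.transpose.rowOf (T.associator T.polytabloid) =
      ((Finset.univ.filter fun π : Perm (Fin n) => ∀ k, T.colOf (π k) = T.colOf k).card : ℂ) := by
    rw [associator_polytabloid, map_sum, Finset.cast_card]
    refine Finset.sum_congr rfl fun π hπ => ?_
    have hπ' : π • T.transpose.rowOf = T.transpose.rowOf :=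
      (T.transpose.smul_rowOf_eq_iff π).2 (Finset.mem_filter.1 hπ).2
    nth_rewrite 1 [← hπ']
    rw [tabloidCoeff_of_smul, coeff_polytabloid]
  rw [h, map_zero] at h1
  exact card_labelStabilizer_ne_zero T.colOf h1.symm

theorem associator_mem_specht (T : Tableau μ) {x : TabloidModule n} (hx : x ∈ specht μ) :
    T.associator x ∈ specht μ.conj := by
  rw [specht_eq_span_singleton T] at hx
  refine mem_of_mem_span_groupAlgebra
    (P := ((specht μ.conj).restrictScalars ℂ).comap T.associator) ?_ ?_ hx
  · intro σ x hx
    rw [Submodule.mem_comap, Submodule.restrictScalars_mem] at hx ⊢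
    rw [T.associator_isSignTwisted]
    exact ((specht μ.conj).restrictScalars ℂ).smul_mem _ ((specht μ.conj).smul_mem _ hx)
  · rw [Set.singleton_subset_iff, SetLike.mem_coe, Submodule.mem_comap,
      Submodule.restrictScalars_mem, associator_polytabloid]
    exact Submodule.sum_mem _ fun π _ =>
      Submodule.smul_mem _ _ (polytabloid_mem_specht T.transpose)

end Tableau

theorem exists_signTwisted_specht {n : ℕ} (μ : Ptn n) :
    ∃ ψ : specht μ →ₗ[ℂ] specht μ.conj, IsSignTwisted n ψ ∧ Function.Injective ψ := by
  obtain ⟨T⟩ := Tableau.exists_tableau μ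
  let ψ : specht μ →ₗ[ℂ] specht μ.conj :=
    T.associator.restrict (p := (specht μ).restrictScalars ℂ)
      (q := (specht μ.conj).restrictScalars ℂ) fun x hx => T.associator_mem_specht hx
  have hψ : IsSignTwisted n ψ := fun σ x => Subtype.ext (T.associator_isSignTwisted σ x)
  refine ⟨ψ, hψ, hψ.injective fun h => T.associator_polytabloid_ne_zero ?_⟩
  exact congrArg Subtype.val
    (LinearMap.congr_fun h (⟨T.polytabloid, polytabloid_mem_specht T⟩ : specht μ))

instance specht_finite {n : ℕ} (μ : Ptn n) : Module.Finite ℂ (specht μ) :=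
  Module.Finite.trans (GroupAlgSn n) (specht μ)

/-- The Specht modules of `μ` and of its double conjugate are the same submodule. -/
def spechtConjConj {n : ℕ} (μ : Ptn n) : specht μ.conj.conj ≃ₗ[GroupAlgSn n] specht μ :=
  LinearEquiv.ofEq _ _ (by rw [Ptn.conj_conj])

/-- By Schur's lemma the composite $\psi^{\mu'}\psi^\mu$ is a scalar $c_\mu$, nonzero by
injectivity. It remains to divide by a square root that is the same for $\mu$ and $\mu'$. -/
theorem exists_associatorFamily (n : ℕ) :
    ∃ φ : ∀ μ : Ptn n, specht μ →ₗ[ℂ] specht μ.conj, IsAssociatorFamily φ := by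
  choose ψ hψ hinj using exists_signTwisted_specht (n := n)
  have hscalar : ∀ μ : Ptn n, ∃ c : ℂ, ∀ x : specht μ,
      (ψ μ.conj (ψ μ x) : TabloidModule n) = c • (x : TabloidModule n) := by
    intro μ
    let E : Module.End (GroupAlgSn n) (specht μ) :=
      (spechtConjConj μ).toLinearMap ∘ₗ
        linearOfEquivariant (ψ μ.conj ∘ₗ ψ μ) ((hψ μ).comp (hψ μ.conj))
    obtain ⟨c, hc⟩ := (IsSimpleModule.algebraMap_end_bijective_of_isAlgClosed ℂ).2 E
    exact ⟨c, fun x => (congrArg Subtype.val (LinearMap.congr_fun hc x)).symm⟩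
  choose c hc using hscalar
  -- Since $\mu''=\mu$ is not definitional, $\psi$ is compared at equal partitions through the
  -- ambient module.
  have hcongr : ∀ (μ ν : Ptn n) (x : specht μ) (y : specht ν), μ = ν →
      (x : TabloidModule n) = y → (ψ μ x : TabloidModule n) = ψ ν y := by
    rintro μ ν x y rfl h
    rw [Subtype.ext h]
  have hne : ∀ μ : Ptn n, ∃ x : specht μ, x ≠ 0 := fun μ =>
    haveI := IsSimpleModule.nontrivial (GroupAlgSn n) (specht μ)
    exists_ne 0
  have hc0 : ∀ μ, c μ ≠ 0 := by
    intro μ h0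
    obtain ⟨x, hx⟩ := hne μ
    have := hc μ x
    rw [h0, zero_smul, Submodule.coe_eq_zero] at this
    exact hx (hinj _ (hinj _ (this.trans ((congrArg _ (map_zero _)).trans (map_zero _)).symm)))
  -- Evaluate $\psi^{\mu}\psi^{\mu'}\psi^{\mu}x$ in two ways.
  have hcc : ∀ μ, c μ.conj = c μ := by
    intro μ
    obtain ⟨x, hx⟩ := hne μ
    have h1 := hc μ.conj (ψ μ x)
    rw [hcongr μ.conj.conj μ (ψ μ.conj (ψ μ x)) (c μ • x) μ.conj_conj (hc μ x), map_smul] at h1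
    have h2 : (ψ μ x : TabloidModule n) ≠ 0 := by
      rw [Ne, Submodule.coe_eq_zero]
      exact fun h => hx (hinj μ (h.trans (map_zero _).symm))
    exact (smul_left_injective ℂ h2 h1).symm
  -- The root is chosen as a function of the scalar, not of the partition, so $c_{\mu'}=c_\mu$ gives
  -- both partitions the same root.
  choose s hs using fun z : ℂ => IsAlgClosed.exists_pow_nat_eq z two_pos
  refine ⟨fun μ => (s (c μ))⁻¹ • ψ μ, fun μ σ x => ?_, fun μ x => ?_⟩
  · rw [LinearMap.smul_apply, LinearMap.smul_apply, hψ μ σ x, complexSign_apply,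
      smul_comm (s (c μ))⁻¹, smul_comm (s (c μ))⁻¹]
  · have hs0 : s (c μ) ≠ 0 := fun h => hc0 μ (by rw [← hs (c μ), h]; simp)
    have h1 : (ψ μ.conj (ψ μ x) : TabloidModule n) = s (c μ) ^ 2 • (x : TabloidModule n) := by
      rw [hs, hc]
    rw [LinearMap.smul_apply, LinearMap.smul_apply, map_smul, hcc]
    change (s (c μ))⁻¹ • (s (c μ))⁻¹ • (ψ μ.conj (ψ μ x) : TabloidModule n) = x
    rw [h1, smul_smul, smul_smul]
    field_simp
    simp

/-! ### The number of simple modules -/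

theorem YoungDiagram.card_cellsOfRowLens (w : List ℕ) :
    (YoungDiagram.cellsOfRowLens w).card = w.sum := by
  induction w with
  | nil => rfl
  | cons a w ih =>
    rw [YoungDiagram.cellsOfRowLens, Finset.card_union_of_disjoint, Finset.card_map, ih]
    · simp
    · rw [Finset.disjoint_left]
      rintro ⟨i, j⟩ h1 h2
      simp only [Finset.mem_product, Finset.mem_singleton, Finset.mem_map] at h1 h2
      obtain ⟨⟨a, b⟩, -, h⟩ := h2
      have := congrArg Prod.fst h
      simp at this
      omega

/-- The Young diagram whose rows are the parts of a partition. -/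
def Ptn.ofPartition {n : ℕ} (p : n.Partition) : Ptn n :=
  ⟨YoungDiagram.ofRowLens (p.parts.sort (· ≥ ·)) (Multiset.pairwise_sort _ _).sortedGE, by
    refine (YoungDiagram.card_cellsOfRowLens _).trans ?_
    rw [← Multiset.sum_coe, Multiset.sort_eq, p.parts_sum]⟩

theorem Ptn.ofPartition_injective {n : ℕ} : Function.Injective (Ptn.ofPartition (n := n)) := by
  intro p q h
  have h1 : ∀ p : n.Partition, (Ptn.ofPartition p).1.rowLens = p.parts.sort (· ≥ ·) := fun p =>
    YoungDiagram.rowLens_ofRowLens_eq_self (hw := (Multiset.pairwise_sort _ _).sortedGE) fun x hx => p.parts_pos ((Multiset.mem_sort _).1 hx)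
  have h2 : p.parts.sort (· ≥ ·) = q.parts.sort (· ≥ ·) := by rw [← h1, ← h1, h]
  refine Nat.Partition.ext ?_
  rw [← Multiset.sort_eq p.parts (· ≥ ·), h2, Multiset.sort_eq]

/-- Cycle types separate conjugacy classes. Only this injection is needed, since it already provides
as many Specht modules as conjugacy classes. -/
theorem exists_injective_conjClasses_ptn (n : ℕ) :
    ∃ ι : ConjClasses (Perm (Fin n)) → Ptn n, Function.Injective ι := by
  have hcard : Fintype.card (Fin n) = n := Fintype.card_fin n
  obtain ⟨F, hF⟩ : ∃ F : (Fintype.card (Fin n)).Partition → Ptn n, Function.Injective F := by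
    rw [hcard]
    exact ⟨_, Ptn.ofPartition_injective⟩
  refine ⟨Quotient.lift (fun σ => F σ.partition) fun σ τ h =>
    congrArg F (Perm.partition_eq_of_isConj.1 h), ?_⟩
  intro x y
  induction x using Quotient.inductionOn
  induction y using Quotient.inductionOn
  intro h
  exact Quotient.sound (Perm.partition_eq_of_isConj.2 (hF h))

section Characters

variable {n : ℕ} {V : Type*} [AddCommGroup V] [Module ℂ V] [Module (GroupAlgSn n) V]
  [IsScalarTower ℂ (GroupAlgSn n) V] {W : Type*} [AddCommGroup W] [Module ℂ W]
  [Module (GroupAlgSn n) W] [IsScalarTower ℂ (GroupAlgSn n) W]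

/-- The representation of `S_n` on a module over the group algebra. -/
abbrev moduleRep (n : ℕ) (V : Type*) [AddCommGroup V] [Module ℂ V] [Module (GroupAlgSn n) V]
    [IsScalarTower ℂ (GroupAlgSn n) V] : Representation ℂ (Perm (Fin n)) V :=
  Representation.ofModule' V

/-- Links simple modules to irreducible representations, for which the character relations are
stated. -/
theorem moduleRep_isIrreducible [IsSimpleModule (GroupAlgSn n) V] :
    (moduleRep n V).IsIrreducible := by
  rw [Representation.irreducible_iff_isSimpleModule_asModule]
  let e : (moduleRep n V).asModule →ₗ[GroupAlgSn n] V :=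
    MonoidAlgebra.equivariantOfLinearOfComm (moduleRep n V).asModuleEquiv.toLinearMap
      fun σ x => by
        exact Representation.asModuleEquiv_map_smul _ _ _ |>.trans (by
          rw [Representation.asAlgebraHom_single_one]; rfl)
  exact IsSimpleModule.congr (LinearEquiv.ofBijective e (moduleRep n V).asModuleEquiv.bijective)

theorem nonempty_linearEquiv_of_moduleRep (h : Nonempty ((moduleRep n V).Equiv (moduleRep n W))) :
    Nonempty (V ≃ₗ[GroupAlgSn n] W) := by
  obtain ⟨e⟩ := h
  let f : V →ₗ[GroupAlgSn n] W :=
    MonoidAlgebra.equivariantOfLinearOfComm e.toLinearEquiv.toLinearMap fun σ x => by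
      exact LinearMap.congr_fun (e.toIntertwiningMap.isIntertwining' σ) x
  exact ⟨LinearEquiv.ofBijective f e.toLinearEquiv.bijective⟩

end Characters

/-- Class functions with the orthogonality relations of distinct irreducible characters are at
most as many as there are conjugacy classes. -/
theorem card_le_card_conjClasses {G ι : Type*} [Group G] [Fintype G] [Fintype ι] [DecidableEq ι]
    (χ : ι → G → ℂ) (hconj : ∀ i g h, χ i (h * g * h⁻¹) = χ i g)
    (horth : ∀ i j, (Nat.card G : ℂ)⁻¹ * ∑ g, χ i g * χ j g⁻¹ = if i = j then 1 else 0) :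
    Fintype.card ι ≤ Nat.card (ConjClasses G) := by
  classical
  have hmk : ∀ i g, χ i g = χ i (Quotient.out (ConjClasses.mk g)) := by
    intro i g
    have : IsConj g (Quotient.out (ConjClasses.mk g)) :=
      (ConjClasses.mk_eq_mk_iff_isConj.1 (Quotient.out_eq (ConjClasses.mk g))).symm
    obtain ⟨h, hh⟩ := isConj_iff.1 this
    rw [← hh, hconj]
  -- Pairing a linear relation with $\chi_j$ isolates the coefficient $a_j$, so the functions are
  -- independent in the space of functions on conjugacy classes.
  have hli : LinearIndependent ℂ fun i => fun c : ConjClasses G => χ i (Quotient.out c) := by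
    rw [Fintype.linearIndependent_iff]
    intro a ha j
    have h1 : ∀ g, ∑ i, a i * χ i g = 0 := fun g => by
      have := congrFun ha (ConjClasses.mk g)
      simp only [Finset.sum_apply, Pi.smul_apply, smul_eq_mul, Pi.zero_apply, ← hmk] at this
      exact this
    have h2 : ∑ i, a i * ((Nat.card G : ℂ)⁻¹ * ∑ g, χ i g * χ j g⁻¹) = 0 := by
      calc _ = (Nat.card G : ℂ)⁻¹ * ∑ g, (∑ i, a i * χ i g) * χ j g⁻¹ := by
            simp only [Finset.mul_sum, Finset.sum_mul]
            rw [Finset.sum_comm]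
            refine Finset.sum_congr rfl fun _ _ => Finset.sum_congr rfl fun _ _ => by ring
        _ = 0 := by simp [h1]
    simp only [horth, mul_ite, mul_one, mul_zero, Finset.sum_ite_eq', Finset.mem_univ,
      if_true] at h2
    exact h2
  have := hli.fintype_card_le_finrank
  rwa [Module.finrank_fintype_fun_eq_card, ← Nat.card_eq_fintype_card (α := ConjClasses G)] at this

/-- Every simple module over the group algebra of `S_n` is a Specht module. -/
theorem exists_specht_equiv {n : ℕ} (V : Type u) [AddCommGroup V] [Module ℂ V]
    [Module (GroupAlgSn n) V] [IsScalarTower ℂ (GroupAlgSn n) V]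
    [IsSimpleModule (GroupAlgSn n) V] : ∃ μ : Ptn n, Nonempty (V ≃ₗ[GroupAlgSn n] specht μ) := by
  classical
  by_contra hV
  push Not at hV
  obtain ⟨ι, hι⟩ := exists_injective_conjClasses_ptn n
  have : Fintype (ConjClasses (Perm (Fin n))) := Fintype.ofFinite _
  have : Module.Finite ℂ V := Module.Finite.trans (GroupAlgSn n) V
  have := moduleRep_isIrreducible (n := n) (V := V)
  have := fun μ : Ptn n => moduleRep_isIrreducible (n := n) (V := specht μ)
  have : Invertible (Nat.card (Perm (Fin n)) : ℂ) := invertibleOfNonzero (by simp)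
  -- One Specht character per conjugacy class together with the character of $V$: one orthonormal
  -- function too many.
  let χ : Option (ConjClasses (Perm (Fin n))) → Perm (Fin n) → ℂ := fun o =>
    o.elim (moduleRep n V).character fun c => (moduleRep n (specht (ι c))).character
  have h := card_le_card_conjClasses χ
    (by
      rintro (_ | c) g h
      · exact Representation.char_conj (moduleRep n V) g h
      · exact Representation.char_conj (moduleRep n (specht (ι c))) g h) (by
      rintro (_ | c) (_ | d)
      · rw [if_pos rfl]
        exact (Representation.char_orthonormal (moduleRep n V) (moduleRep n V)).trans
          (if_pos ⟨.refl _⟩)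
      · rw [if_neg (by simp)]
        refine (Representation.char_orthonormal (moduleRep n V)
          (moduleRep n (specht (ι d)))).trans (if_neg fun h => ?_)
        obtain ⟨e⟩ := nonempty_linearEquiv_of_moduleRep h
        exact (hV (ι d)).false e.symm
      · rw [if_neg (by simp)]
        refine (Representation.char_orthonormal (moduleRep n (specht (ι c)))
          (moduleRep n V)).trans (if_neg fun h => ?_)
        obtain ⟨e⟩ := nonempty_linearEquiv_of_moduleRep h
        exact (hV (ι c)).false e
      · refine (Representation.char_orthonormal (moduleRep n (specht (ι c)))
          (moduleRep n (specht (ι d)))).trans ?_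
        by_cases hcd : c = d
        · subst hcd
          rw [if_pos rfl]
          exact if_pos ⟨.refl _⟩
        · refine (if_neg fun h => hcd ?_).trans (if_neg (by simpa using hcd)).symm
          exact (hι (eq_of_specht_equiv (nonempty_linearEquiv_of_moduleRep h))).symm)
  rw [Fintype.card_option, Nat.card_eq_fintype_card] at h
  omega

/-! ### Supermodules as modules with a sign-twisted involution -/

theorem neg_one_pow_val_add (i j : ZMod 2) :
    (-1 : ℂ) ^ (i + j).val = (-1) ^ i.val * (-1) ^ j.val := by
  rw [ZMod.val_add, ← pow_add, ← neg_one_pow_eq_pow_mod_two]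

theorem neg_one_pow_mul_self (k : ℕ) : (-1 : ℂ) ^ k * (-1) ^ k = 1 := by
  rw [← mul_pow]; simp

theorem complexSign_eq_neg_one_pow {n : ℕ} (σ : Perm (Fin n)) :
    complexSign σ = (-1) ^ (permParity σ).val := by
  rcases Int.units_eq_one_or (Perm.sign σ) with h | h <;>
    simp [complexSign_apply, permParity, h, ZMod.val_one]

theorem of_mem_snGrading {n : ℕ} (σ : Perm (Fin n)) :
    MonoidAlgebra.of ℂ _ σ ∈ snGrading n (permParity σ) :=
  Submodule.subset_span ⟨σ, rfl, rfl⟩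

theorem ZMod.two_eq_zero_or_one (i : ZMod 2) : i = 0 ∨ i = 1 := by
  revert i; decide

namespace Supermodule

section General

variable {A : Type v} [Ring A] [Algebra ℂ A] {𝒜 : ZMod 2 → Submodule ℂ A} [GradedAlgebra 𝒜]

/-- The linear map that is the identity on the even part and minus the identity on the odd part. -/
def parityMap (V : Supermodule.{u} 𝒜) : V.carrier →ₗ[ℂ] V.carrier :=
  LinearMap.ofIsCompl V.isCompl (V.grade 0).subtype (-(V.grade 1).subtype)

theorem parityMap_of_mem_zero (V : Supermodule.{u} 𝒜) {x : V.carrier} (hx : x ∈ V.grade 0) :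
    V.parityMap x = x :=
  LinearMap.ofIsCompl_apply_left V.isCompl ⟨x, hx⟩

theorem parityMap_of_mem_one (V : Supermodule.{u} 𝒜) {x : V.carrier} (hx : x ∈ V.grade 1) :
    V.parityMap x = -x :=
  LinearMap.ofIsCompl_apply_right V.isCompl ⟨x, hx⟩

theorem exists_homogeneous_add (V : Supermodule.{u} 𝒜) (x : V.carrier) :
    ∃ a ∈ V.grade 0, ∃ b ∈ V.grade 1, a + b = x :=
  Submodule.mem_sup.1 (by rw [V.isCompl.sup_eq_top]; trivial)

theorem parityMap_of_mem (V : Supermodule.{u} 𝒜) {i : ZMod 2} {x : V.carrier}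
    (hx : x ∈ V.grade i) : V.parityMap x = (-1 : ℂ) ^ i.val • x := by
  rcases ZMod.two_eq_zero_or_one i with rfl | rfl
  · simpa using V.parityMap_of_mem_zero hx
  · simpa [ZMod.val_one] using V.parityMap_of_mem_one hx

/-- The component of the wrong parity equals its own negative and hence vanishes. The grading is
thus encoded in the parity map. -/
theorem mem_grade_iff (V : Supermodule.{u} 𝒜) {i : ZMod 2} {x : V.carrier} :
    x ∈ V.grade i ↔ V.parityMap x = (-1 : ℂ) ^ i.val • x := by
  refine ⟨V.parityMap_of_mem, fun h => ?_⟩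
  obtain ⟨a, ha, b, hb, rfl⟩ := V.exists_homogeneous_add x
  rw [map_add, V.parityMap_of_mem_zero ha, V.parityMap_of_mem_one hb] at h
  rcases ZMod.two_eq_zero_or_one i with rfl | rfl
  · have h2 : (2 : ℂ) • b = 0 := by
      simp only [ZMod.val_zero, pow_zero, one_smul] at h
      have := add_left_cancel h
      rw [two_smul, add_eq_zero_iff_neg_eq]
      exact this
    rw [(smul_eq_zero.1 h2).resolve_left two_ne_zero, add_zero]
    exact ha
  · have h2 : (2 : ℂ) • a = 0 := by
      simp only [ZMod.val_one, pow_one, neg_smul, one_smul, neg_add] at h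
      have := add_right_cancel h
      rw [two_smul, add_eq_zero_iff_eq_neg]
      exact this
    rw [(smul_eq_zero.1 h2).resolve_left two_ne_zero, zero_add]
    exact hb

theorem parityMap_parityMap (V : Supermodule.{u} 𝒜) (x : V.carrier) :
    V.parityMap (V.parityMap x) = x := by
  obtain ⟨a, ha, b, hb, rfl⟩ := V.exists_homogeneous_add x
  simp only [map_add, V.parityMap_of_mem_zero ha, V.parityMap_of_mem_one hb, map_neg, neg_neg]

/-- The even component of $x$ is half the sum of $x$ and its image under the parity map. -/
theorem isSubsupermodule_iff (V : Supermodule.{u} 𝒜) (N : Submodule A V.carrier) :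
    V.IsSubsupermodule N ↔ ∀ x ∈ N, V.parityMap x ∈ N := by
  constructor
  · intro h x hx
    obtain ⟨a, ha, b, hb, rfl⟩ := V.exists_homogeneous_add x
    rw [map_add, V.parityMap_of_mem_zero ha, V.parityMap_of_mem_one hb]
    exact N.add_mem (h a ha b hb hx).1 (N.neg_mem (h a ha b hb hx).2)
  · intro h a ha b hb hx
    have h1 := h _ hx
    rw [map_add, V.parityMap_of_mem_zero ha, V.parityMap_of_mem_one hb] at h1
    have h2 : a ∈ N := by
      have := (N.restrictScalars ℂ).smul_mem (2⁻¹ : ℂ) (N.add_mem hx h1)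
      rw [add_add_add_comm, add_neg_cancel, add_zero, ← two_smul ℂ a, inv_smul_smul₀ two_ne_zero]
        at this
      exact this
    exact ⟨h2, (N.add_mem_iff_right h2).1 hx⟩

/-- A nonzero module homomorphism to a simple supermodule is onto if its range is stable under
the parity map. -/
theorem IsSimple.surjective {V : Supermodule.{u} 𝒜} (hV : V.IsSimple) {S : Type*} [AddCommGroup S]
    [Module A S] (g : S →ₗ[A] V.carrier) (h0 : g ≠ 0)
    (hg : ∀ x, ∃ y, V.parityMap (g x) = g y) : Function.Surjective g := by
  rw [← LinearMap.range_eq_top]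
  refine (hV.2 _ ((V.isSubsupermodule_iff _).2 ?_)).resolve_left ?_
  · rintro _ ⟨x, rfl⟩
    obtain ⟨y, hy⟩ := hg x
    exact ⟨y, hy.symm⟩
  · rwa [LinearMap.range_eq_bot]

theorem IsSimple.injective {V : Supermodule.{u} 𝒜} (hV : V.IsSimple) {S : Type*} [AddCommGroup S]
    [Module A S] (g : V.carrier →ₗ[A] S) (h0 : g ≠ 0)
    (hg : ∀ x, g x = 0 → g (V.parityMap x) = 0) : Function.Injective g := by
  rw [← LinearMap.ker_eq_bot]
  refine (hV.2 _ ((V.isSubsupermodule_iff _).2 ?_)).resolve_right ?_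
  · exact hg
  · rwa [LinearMap.ker_eq_top]

end General

variable {n : ℕ}

/-- A permutation of parity $i$ shifts degrees by $i$, which multiplies the eigenvalue by $(-1)^i$,
its sign. -/
theorem parityMap_isSignTwisted (V : Supermodule.{u} (snGrading n)) :
    IsSignTwisted n V.parityMap := by
  intro σ x
  obtain ⟨a, ha, b, hb, rfl⟩ := V.exists_homogeneous_add x
  have h0 := V.parityMap_of_mem (V.smul_mem _ _ _ _ (of_mem_snGrading σ) ha)
  have h1 := V.parityMap_of_mem (V.smul_mem _ _ _ _ (of_mem_snGrading σ) hb)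
  rw [neg_one_pow_val_add, ← complexSign_eq_neg_one_pow] at h0 h1
  rw [smul_add, map_add, map_add, h0, h1, V.parityMap_of_mem_zero ha, V.parityMap_of_mem_one hb,
    smul_add, smul_add]
  simp [ZMod.val_one]

/-- The supermodule given by a module with a sign-twisted involution. -/
abbrev ofInvolution {V : Type u} [AddCommGroup V] [Module ℂ V] [Module (GroupAlgSn n) V]
    [IsScalarTower ℂ (GroupAlgSn n) V] (δ : V →ₗ[ℂ] V) (hδ : ∀ x, δ (δ x) = x)
    (ht : IsSignTwisted n δ) : Supermodule.{u} (snGrading n) where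
  carrier := V
  grade i := LinearMap.eqLocus δ ((-1 : ℂ) ^ i.val • LinearMap.id)
  isCompl := by
    constructor
    · rw [Submodule.disjoint_def]
      intro x h0 h1
      rw [LinearMap.mem_eqLocus] at h0 h1
      simp only [ZMod.val_zero, pow_zero, one_smul, LinearMap.id_apply, ZMod.val_one, pow_one,
        neg_smul, LinearMap.neg_apply] at h0 h1
      have h2 : (2 : ℂ) • x = 0 := by
        rw [two_smul, add_eq_zero_iff_eq_neg, ← h1, h0]
      exact (smul_eq_zero.1 h2).resolve_left two_ne_zero
    · rw [codisjoint_iff, eq_top_iff]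
      intro x _
      -- The eigenspace projections of an involution.
      refine Submodule.mem_sup.2 ⟨(2⁻¹ : ℂ) • (x + δ x), ?_, (2⁻¹ : ℂ) • (x - δ x), ?_, ?_⟩
      · rw [LinearMap.mem_eqLocus]
        simp [hδ, add_comm]
      · rw [LinearMap.mem_eqLocus]
        simp only [map_smul, map_sub, hδ, ZMod.val_one, pow_one, neg_smul, one_smul,
          LinearMap.neg_apply, LinearMap.id_apply]
        congr 1
        abel
      · rw [← smul_add, add_add_sub_cancel, ← two_smul ℂ x, inv_smul_smul₀ two_ne_zero]
  smul_mem i j a x ha hx := by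
    rw [snGrading] at ha
    induction ha using Submodule.span_induction with
    | mem a h =>
      obtain ⟨σ, rfl, rfl⟩ := h
      rw [LinearMap.mem_eqLocus] at hx ⊢
      rw [ht, hx, neg_one_pow_val_add, ← complexSign_eq_neg_one_pow, LinearMap.smul_apply,
        LinearMap.smul_apply, LinearMap.id_apply, LinearMap.id_apply, mul_smul,
        smul_comm (MonoidAlgebra.of ℂ _ σ)]
    | zero => rw [zero_smul]; exact Submodule.zero_mem _
    | add a b _ _ ha hb => rw [add_smul]; exact Submodule.add_mem _ ha hb
    | smul c a _ ha => rw [smul_assoc]; exact Submodule.smul_mem _ _ ha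

theorem parityMap_ofInvolution {V : Type u} [AddCommGroup V] [Module ℂ V]
    [Module (GroupAlgSn n) V] [IsScalarTower ℂ (GroupAlgSn n) V] (δ : V →ₗ[ℂ] V)
    (hδ : ∀ x, δ (δ x) = x) (ht : IsSignTwisted n δ) (x : V) :
    (ofInvolution δ hδ ht).parityMap x = δ x := by
  obtain ⟨a, ha, b, hb, rfl⟩ := (ofInvolution δ hδ ht).exists_homogeneous_add x
  have h0 : δ a = a := by simpa using LinearMap.mem_eqLocus.1 ha
  have h1 : δ b = -b := by simpa [ZMod.val_one] using LinearMap.mem_eqLocus.1 hb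
  rw [map_add, map_add, parityMap_of_mem_zero _ ha, parityMap_of_mem_one _ hb, h0, h1]

/-- A bijection that respects the parity maps and the actions of `S_n` up to the appropriate signs
gives a homogeneous isomorphism in the opposite direction. -/
theorem homogeneouslyIsomorphic_of_bijective {V : Supermodule.{u} (snGrading n)}
    {W : Supermodule.{w} (snGrading n)} (p : ZMod 2) (g : W.carrier →ₗ[ℂ] V.carrier)
    (hg : Function.Bijective g)
    (hσ : ∀ (σ : Perm (Fin n)) (x), g (MonoidAlgebra.of ℂ _ σ • x) =
      complexSign σ ^ p.val • MonoidAlgebra.of ℂ _ σ • g x)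
    (hδ : ∀ x, g (W.parityMap x) = (-1 : ℂ) ^ p.val • V.parityMap (g x)) :
    V.HomogeneouslyIsomorphic W := by
  let h := LinearEquiv.ofBijective g hg
  have hgh : ∀ y, g (h.symm y) = y := fun y => h.apply_symm_apply y
  refine ⟨p, h.symm.toLinearMap, ⟨fun i x hx => ?_, fun i a ha x => ?_⟩, h.symm.bijective⟩
  · rw [mem_grade_iff] at hx ⊢
    apply hg.1
    simp only [LinearEquiv.coe_coe, hδ, map_smul, hgh, hx]
    rw [neg_one_pow_val_add, smul_smul, mul_comm]
  · apply hg.1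
    simp only [LinearEquiv.coe_coe, map_smul, hgh]
    rw [snGrading] at ha
    induction ha using Submodule.span_induction with
    | mem a ha =>
      obtain ⟨σ, rfl, rfl⟩ := ha
      rw [hσ, hgh, complexSign_eq_neg_one_pow, ← pow_mul, smul_smul, neg_one_pow_mul_self, one_smul]
    | zero => simp
    | add a b _ _ ha hb => rw [add_smul, add_smul, map_add, smul_add, ← ha, ← hb]
    | smul c a _ ha => rw [smul_assoc, ha, smul_assoc, g.map_smul, smul_comm c]

/-- Forgetting the grading leaves a linear or a sign-twisted bijection, which is enough to compare
simple constituents. -/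
theorem HomogeneouslyIsomorphic.exists_bijective {V : Supermodule.{u} (snGrading n)}
    {W : Supermodule.{w} (snGrading n)} (h : V.HomogeneouslyIsomorphic W) :
    (∃ f : V.carrier →ₗ[GroupAlgSn n] W.carrier, Function.Bijective f) ∨
      ∃ f : V.carrier →ₗ[ℂ] W.carrier, IsSignTwisted n f ∧ Function.Bijective f := by
  obtain ⟨p, f, ⟨-, hf⟩, hb⟩ := h
  rcases ZMod.two_eq_zero_or_one p with rfl | rfl
  · refine Or.inl ⟨linearOfEquivariant f fun σ x => ?_, hb⟩
    simpa using hf _ _ (of_mem_snGrading σ) x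
  · refine Or.inr ⟨f, fun σ x => ?_, hb⟩
    rw [complexSign_eq_neg_one_pow]
    simpa [ZMod.val_one] using hf _ _ (of_mem_snGrading σ) x

end Supermodule

/-! ### Products of two non-isomorphic simple modules -/

section Product

variable {A : Type*} [Ring A] {M S S' : Type*} [AddCommGroup M] [Module A M] [AddCommGroup S]
  [Module A S] [AddCommGroup S'] [Module A S'] [IsSimpleModule A S] [IsSimpleModule A S']

theorem linearMap_eq_zero_of_not_equiv (hne : ¬ Nonempty (S ≃ₗ[A] S')) (f : S →ₗ[A] S') : f = 0 :=
  f.bijective_or_eq_zero.resolve_left fun h => hne ⟨LinearEquiv.ofBijective f h⟩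

/-- The first factor is the only submodule of its isomorphism type. -/
theorem nonempty_equiv_fst_iff (hne : ¬ Nonempty (S ≃ₗ[A] S')) (e : M ≃ₗ[A] S × S')
    (N : Submodule A M) : Nonempty (N ≃ₗ[A] S) ↔ ∀ w, w ∈ N ↔ (e w).2 = 0 := by
  constructor
  · rintro ⟨f⟩
    have h2 : ∀ w ∈ N, (e w).2 = 0 := by
      intro w hw
      have := LinearMap.congr_fun (linearMap_eq_zero_of_not_equiv hne
        (LinearMap.snd A S S' ∘ₗ e.toLinearMap ∘ₗ N.subtype ∘ₗ f.symm.toLinearMap)) (f ⟨w, hw⟩)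
      simpa using this
    let g : S →ₗ[A] S := LinearMap.fst A S S' ∘ₗ e.toLinearMap ∘ₗ N.subtype ∘ₗ f.symm.toLinearMap
    have hg : Function.Injective g := by
      rw [injective_iff_map_eq_zero]
      intro x hx
      have h1 : e (f.symm x) = 0 := Prod.ext hx (h2 _ (f.symm x).2)
      simpa using h1
    -- By Schur, the first projection maps the copy of $S$ onto all of $S$, so $N$ fills the first
    -- factor.
    have hg' : Function.Bijective g := g.bijective_or_eq_zero.resolve_right fun h => by
      have := IsSimpleModule.nontrivial A S
      obtain ⟨x, hx⟩ := exists_ne (0 : S)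
      exact hx (hg (by rw [h]; rfl))
    refine fun w => ⟨h2 w, fun hw => ?_⟩
    obtain ⟨x, hx⟩ := hg'.2 (e w).1
    have : e w = e (f.symm x) := Prod.ext hx.symm (hw.trans (h2 _ (f.symm x).2).symm)
    rw [e.injective this]
    exact (f.symm x).2
  · intro h
    let g : N →ₗ[A] S := LinearMap.fst A S S' ∘ₗ e.toLinearMap ∘ₗ N.subtype
    refine ⟨LinearEquiv.ofBijective g ⟨?_, fun x => ?_⟩⟩
    · rw [injective_iff_map_eq_zero]
      intro x hx
      have h1 : e x = 0 := Prod.ext hx ((h _).1 x.2)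
      simpa using h1
    · exact ⟨⟨e.symm (x, 0), (h _).2 (by simp)⟩, by simp [g]⟩

theorem nonempty_equiv_snd_iff (hne : ¬ Nonempty (S ≃ₗ[A] S')) (e : M ≃ₗ[A] S × S')
    (N : Submodule A M) : Nonempty (N ≃ₗ[A] S') ↔ ∀ w, w ∈ N ↔ (e w).1 = 0 :=
  nonempty_equiv_fst_iff (fun ⟨f⟩ => hne ⟨f.symm⟩) (e.trans (LinearEquiv.prodComm A S S')) N

/-- A nonzero submodule of the product contains one of the factors. -/
theorem inl_mem_or_inr_mem (hne : ¬ Nonempty (S ≃ₗ[A] S')) {N : Submodule A (S × S')}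
    (hN : N ≠ ⊥) : (∀ x : S, (x, (0 : S')) ∈ N) ∨ ∀ y : S', ((0 : S), y) ∈ N := by
  rcases eq_bot_or_eq_top (N.comap (LinearMap.inl A S S')) with h1 | h1
  · rcases eq_bot_or_eq_top (N.comap (LinearMap.inr A S S')) with h2 | h2
    · exfalso
      let f : N →ₗ[A] S := LinearMap.fst A S S' ∘ₗ N.subtype
      let g : N →ₗ[A] S' := LinearMap.snd A S S' ∘ₗ N.subtype
      have := Submodule.nontrivial_iff_ne_bot.2 hN
      obtain ⟨z, hz⟩ := exists_ne (0 : N)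
      have hf : Function.Injective f := by
        rw [injective_iff_map_eq_zero]
        rintro ⟨⟨x, y⟩, hxy⟩ h
        have hx : x = 0 := h
        subst hx
        have : y ∈ N.comap (LinearMap.inr A S S') := hxy
        rw [h2] at this
        have hy : y = 0 := this
        subst hy
        rfl
      have hg : Function.Injective g := by
        rw [injective_iff_map_eq_zero]
        rintro ⟨⟨x, y⟩, hxy⟩ h
        have hy : y = 0 := h
        subst hy
        have : x ∈ N.comap (LinearMap.inl A S S') := hxy
        rw [h1] at this
        have hx : x = 0 := this
        subst hx
        rfl
      have hf' : Function.Surjective f := f.surjective_or_eq_zero.resolve_right fun h =>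
        hz (hf (by rw [h]; rfl))
      have hg' : Function.Surjective g := g.surjective_or_eq_zero.resolve_right fun h =>
        hz (hg (by rw [h]; rfl))
      exact hne ⟨(LinearEquiv.ofBijective f ⟨hf, hf'⟩).symm.trans
        (LinearEquiv.ofBijective g ⟨hg, hg'⟩)⟩
    · right
      intro y
      have : y ∈ N.comap (LinearMap.inr A S S') := by rw [h2]; trivial
      exact this
  · left
    intro x
    have : x ∈ N.comap (LinearMap.inl A S S') := by rw [h1]; trivial
    exact this

theorem not_isSimpleModule_prod (e : M ≃ₗ[A] S × S') : ¬ IsSimpleModule A M := by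
  intro h
  have := IsSimpleModule.nontrivial A S
  have := IsSimpleModule.nontrivial A S'
  obtain ⟨x, hx⟩ := exists_ne (0 : S)
  obtain ⟨y, hy⟩ := exists_ne (0 : S')
  rcases eq_bot_or_eq_top (LinearMap.ker (LinearMap.fst A S S' ∘ₗ e.toLinearMap)) with h | h
  · have h1 : e.symm (0, y) ∈ LinearMap.ker (LinearMap.fst A S S' ∘ₗ e.toLinearMap) := by simp
    rw [h, Submodule.mem_bot, LinearEquiv.symm_apply_eq, map_zero] at h1
    exact hy (Prod.ext_iff.1 h1).2
  · have h1 : e.symm (x, 0) ∈ LinearMap.ker (LinearMap.fst A S S' ∘ₗ e.toLinearMap) := by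
      rw [h]; trivial
    exact hx (by simpa using h1)

end Product

/-! ### Supermodules of Type Q -/

section TypeQ

variable {n : ℕ} {S : Type w} [AddCommGroup S] [Module ℂ S] [Module (GroupAlgSn n) S]
  [IsScalarTower ℂ (GroupAlgSn n) S] {S' : Type w} [AddCommGroup S'] [Module ℂ S']
  [Module (GroupAlgSn n) S'] [IsScalarTower ℂ (GroupAlgSn n) S']
  [IsSimpleModule (GroupAlgSn n) S] [IsSimpleModule (GroupAlgSn n) S']

/-- The product of a simple module and a non-isomorphic sign-twist of it is a simple supermodule
of Type Q. -/
theorem exists_isSimpleTypeQ (hne : ¬ Nonempty (S ≃ₗ[GroupAlgSn n] S')) (φ : S →ₗ[ℂ] S')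
    (ψ : S' →ₗ[ℂ] S) (hφ : IsSignTwisted n φ) (hψ : IsSignTwisted n ψ) (hψφ : ∀ x, ψ (φ x) = x)
    (hφψ : ∀ y, φ (ψ y) = y) :
    ∃ W : Supermodule.{w} (snGrading n), W.IsSimpleTypeQ ∧
      ∃ e : W.carrier ≃ₗ[GroupAlgSn n] S × S',
        (∀ w, w ∈ W.grade 0 ↔ ∃ x, e w = (x, φ x)) ∧
        ∀ w, w ∈ W.grade 1 ↔ ∃ x, e w = (x, -φ x) := by
  let δ : S × S' →ₗ[ℂ] S × S' := (ψ ∘ₗ LinearMap.snd ℂ S S').prod (φ ∘ₗ LinearMap.fst ℂ S S')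
  have hδ : ∀ x, δ (δ x) = x := fun x => Prod.ext (hψφ _) (hφψ _)
  have ht : IsSignTwisted n δ := fun σ x => Prod.ext (hψ σ x.2) (hφ σ x.1)
  let W : Supermodule.{w} (snGrading n) := Supermodule.ofInvolution δ hδ ht
  have hmem : ∀ (i : ZMod 2) (w : S × S'), w ∈ W.grade i ↔ δ w = (-1 : ℂ) ^ i.val • w :=
    fun i w => LinearMap.mem_eqLocus
  refine ⟨W, ⟨⟨?_, fun N hN => ?_⟩, ?_⟩, LinearEquiv.refl _ (S × S'), fun w => ?_, fun w => ?_⟩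
  · have := IsSimpleModule.nontrivial (GroupAlgSn n) S
    exact inferInstanceAs (Nontrivial (S × S'))
  · rw [Supermodule.isSubsupermodule_iff] at hN
    have hN' : ∀ x : S × S', x ∈ N → δ x ∈ N := fun x hx => by
      have := hN x hx
      rwa [Supermodule.parityMap_ofInvolution] at this
    by_cases h0 : N = ⊥
    · exact Or.inl h0
    · right
      rw [eq_top_iff]
      rintro ⟨x, y⟩ -
      have hxy : ((x, y) : S × S') = (x, 0) + (0, y) := by simp
      rw [hxy]
      -- A submodule containing one factor contains the other as its image under $\delta$.
      rcases inl_mem_or_inr_mem hne h0 with h | h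
      · refine N.add_mem (h x) ?_
        have := hN' _ (h (ψ y))
        simpa [δ, hφψ] using this
      · refine N.add_mem ?_ (h y)
        have := hN' _ (h (φ x))
        simpa [δ, hψφ] using this
  · exact not_isSimpleModule_prod (LinearEquiv.refl (GroupAlgSn n) (S × S'))
  · refine (hmem 0 w).trans ⟨fun h => ⟨w.1, ?_⟩, ?_⟩
    · rw [ZMod.val_zero, pow_zero, one_smul] at h
      exact Prod.ext rfl (Prod.ext_iff.1 h).2.symm
    · rintro ⟨x, rfl⟩
      rw [ZMod.val_zero, pow_zero, one_smul]
      exact Prod.ext (hψφ x) rfl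
  · refine (hmem 1 w).trans ⟨fun h => ⟨w.1, ?_⟩, ?_⟩
    · rw [ZMod.val_one, pow_one, neg_smul, one_smul] at h
      refine Prod.ext rfl ?_
      have := (Prod.ext_iff.1 h).2
      exact (neg_eq_iff_eq_neg.2 this).symm
    · rintro ⟨x, rfl⟩
      rw [ZMod.val_one, pow_one, neg_smul, one_smul]
      refine Prod.ext ?_ ?_
      · change ψ (-φ x) = -x
        rw [map_neg, hψφ]
      · exact (neg_neg (φ x)).symm

variable {W : Supermodule.{w} (snGrading n)} {φ : S →ₗ[ℂ] S'} {ψ : S' →ₗ[ℂ] S}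
  (e : W.carrier ≃ₗ[GroupAlgSn n] S × S')

theorem apply_parityMap_typeQ (hψφ : ∀ x, ψ (φ x) = x)
    (h0 : ∀ w, w ∈ W.grade 0 ↔ ∃ x, e w = (x, φ x))
    (h1 : ∀ w, w ∈ W.grade 1 ↔ ∃ x, e w = (x, -φ x)) (w : W.carrier) :
    e (W.parityMap w) = (ψ (e w).2, φ (e w).1) := by
  obtain ⟨a, ha, b, hb, rfl⟩ := W.exists_homogeneous_add w
  obtain ⟨x, hx⟩ := (h0 a).1 ha
  obtain ⟨y, hy⟩ := (h1 b).1 hb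
  rw [map_add, W.parityMap_of_mem_zero ha, W.parityMap_of_mem_one hb, map_add, map_add, map_neg,
    hx, hy]
  simp [hψφ]

/-- The graphs of $\phi$ and $-\phi$ together span, which gives uniqueness and reduces every
property of $J$ to these vectors. -/
theorem existsUnique_oddInvolution
    (h0 : ∀ w, w ∈ W.grade 0 ↔ ∃ x, e w = (x, φ x))
    (h1 : ∀ w, w ∈ W.grade 1 ↔ ∃ x, e w = (x, -φ x)) :
    (∃! J : W.carrier →ₗ[ℂ] W.carrier, ∀ x : S,
      J (e.symm (x, φ x)) = e.symm (x, -φ x) ∧ J (e.symm (x, -φ x)) = e.symm (x, φ x)) ∧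
    ∀ J : W.carrier →ₗ[ℂ] W.carrier, (∀ x : S,
      J (e.symm (x, φ x)) = e.symm (x, -φ x) ∧ J (e.symm (x, -φ x)) = e.symm (x, φ x)) →
      W.IsOddInvolution J := by
  have hdec : ∀ w : W.carrier, ∃ x y : S, w = e.symm (x, φ x) + e.symm (y, -φ y) := by
    intro w
    obtain ⟨a, ha, b, hb, rfl⟩ := W.exists_homogeneous_add w
    obtain ⟨x, hx⟩ := (h0 a).1 ha
    obtain ⟨y, hy⟩ := (h1 b).1 hb
    exact ⟨x, y, by rw [← hx, ← hy, e.symm_apply_apply, e.symm_apply_apply]⟩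
  refine ⟨⟨?_, ?_, ?_⟩, fun J hJ => ⟨fun i w hw => ?_, fun w => ?_⟩⟩
  · exact ((e.symm.toLinearMap ∘ₗ
      (LinearMap.fst (GroupAlgSn n) S S').prod (-LinearMap.snd (GroupAlgSn n) S S')) ∘ₗ
        e.toLinearMap).restrictScalars ℂ
  · intro x
    simp
  · intro J hJ
    ext w
    obtain ⟨x, y, rfl⟩ := hdec w
    rw [map_add, (hJ x).1, (hJ y).2, map_add]
    simp
  · rcases ZMod.two_eq_zero_or_one i with rfl | rfl
    · obtain ⟨x, hx⟩ := (h0 w).1 hw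
      rw [← e.symm_apply_eq.2 hx.symm, (hJ x).1]
      exact (h1 _).2 ⟨x, e.apply_symm_apply _⟩
    · obtain ⟨x, hx⟩ := (h1 w).1 hw
      rw [← e.symm_apply_eq.2 hx.symm, (hJ x).2]
      exact (h0 _).2 ⟨x, e.apply_symm_apply _⟩
  · obtain ⟨x, y, rfl⟩ := hdec w
    rw [map_add, (hJ x).1, (hJ y).2, map_add, (hJ x).2, (hJ y).1]

/-- A simple supermodule containing the first factor is isomorphic to the supermodule of Type Q. -/
theorem homogeneouslyIsomorphic_typeQ (hW : W.IsSimple) (hψ : IsSignTwisted n ψ)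
    (hψφ : ∀ x, ψ (φ x) = x)
    (h0 : ∀ w, w ∈ W.grade 0 ↔ ∃ x, e w = (x, φ x))
    (h1 : ∀ w, w ∈ W.grade 1 ↔ ∃ x, e w = (x, -φ x))
    {V : Supermodule.{u} (snGrading n)} (hV : V.IsSimple) (f : S →ₗ[GroupAlgSn n] V.carrier)
    (hf : f ≠ 0) : V.HomogeneouslyIsomorphic W := by
  have hfψ : IsSignTwisted n (f.restrictScalars ℂ ∘ₗ ψ) := fun σ x => by
    simp only [LinearMap.comp_apply, hψ σ x, map_smul, LinearMap.coe_restrictScalars]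
  -- The twists of $\psi$ and of the parity map cancel, so the composite is a module map; $f$ and
  -- $k$ together then commute with the parity maps.
  let k : S' →ₗ[GroupAlgSn n] V.carrier :=
    linearOfEquivariant (V.parityMap ∘ₗ f.restrictScalars ℂ ∘ₗ ψ)
      (hfψ.comp V.parityMap_isSignTwisted)
  let g : W.carrier →ₗ[GroupAlgSn n] V.carrier := (f.coprod k) ∘ₗ e.toLinearMap
  have hg : ∀ w, g w = f (e w).1 + V.parityMap (f (ψ (e w).2)) := fun w => rfl
  have hparity : ∀ w, g (W.parityMap w) = V.parityMap (g w) := by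
    intro w
    rw [hg, hg, apply_parityMap_typeQ e hψφ h0 h1, map_add, V.parityMap_parityMap, hψφ, add_comm]
  have hg0 : g ≠ 0 := by
    intro h
    refine hf (LinearMap.ext fun x => ?_)
    have := LinearMap.congr_fun h (e.symm (x, 0))
    rw [hg] at this
    simpa using this
  refine Supermodule.homogeneouslyIsomorphic_of_bijective 0 (g.restrictScalars ℂ) ⟨?_, ?_⟩ ?_ ?_
  · refine hW.injective g hg0 fun w hw => ?_
    rw [hparity, hw, map_zero]
  · exact hV.surjective g hg0 fun w => ⟨_, (hparity w).symm⟩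
  · intro σ x
    simp
  · intro w
    simpa using hparity w

end TypeQ

/-! ### Supermodules of Type M -/

section TypeM

variable {n : ℕ} {S : Type w} [AddCommGroup S] [Module ℂ S] [Module (GroupAlgSn n) S]
  [IsScalarTower ℂ (GroupAlgSn n) S] [IsSimpleModule (GroupAlgSn n) S]

/-- A simple module with a sign-twisted involution is a simple supermodule of Type M. -/
theorem exists_isSimpleTypeM (φ : S →ₗ[ℂ] S) (hφ : IsSignTwisted n φ) (hφφ : ∀ x, φ (φ x) = x) :
    ∃ W : Supermodule.{w} (snGrading n), W.IsSimpleTypeM ∧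
      ∃ e : W.carrier ≃ₗ[GroupAlgSn n] S,
        (∀ w, w ∈ W.grade 0 ↔ φ (e w) = e w) ∧ ∀ w, w ∈ W.grade 1 ↔ φ (e w) = -e w := by
  let W : Supermodule.{w} (snGrading n) := Supermodule.ofInvolution φ hφφ hφ
  have hsimple : IsSimpleModule (GroupAlgSn n) W.carrier :=
    inferInstanceAs (IsSimpleModule (GroupAlgSn n) S)
  have hmem : ∀ (i : ZMod 2) (w : S), w ∈ W.grade i ↔ φ w = (-1 : ℂ) ^ i.val • w :=
    fun i w => LinearMap.mem_eqLocus
  refine ⟨W, ⟨⟨IsSimpleModule.nontrivial (GroupAlgSn n) W.carrier, fun N _ =>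
    eq_bot_or_eq_top N⟩, hsimple⟩, LinearEquiv.refl _ S, fun w => ?_, fun w => ?_⟩
  · refine (hmem 0 w).trans ?_
    rw [ZMod.val_zero, pow_zero, one_smul]
    rfl
  · refine (hmem 1 w).trans ?_
    rw [ZMod.val_one, pow_one, neg_smul, one_smul]
    rfl

/-- A simple supermodule containing a simple module with a sign-twisted involution is isomorphic
to the supermodule of Type M. -/
theorem homogeneouslyIsomorphic_typeM {W : Supermodule.{w} (snGrading n)} {φ : S →ₗ[ℂ] S}
    (hφ : IsSignTwisted n φ) (hφφ : ∀ x, φ (φ x) = x) (e : W.carrier ≃ₗ[GroupAlgSn n] S)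
    (h0 : ∀ w, w ∈ W.grade 0 ↔ φ (e w) = e w) (h1 : ∀ w, w ∈ W.grade 1 ↔ φ (e w) = -e w)
    {V : Supermodule.{u} (snGrading n)} (hV : V.IsSimple) (f : S →ₗ[GroupAlgSn n] V.carrier)
    (hf : f ≠ 0) : V.HomogeneouslyIsomorphic W := by
  have hparW : ∀ w, e (W.parityMap w) = φ (e w) := by
    intro w
    obtain ⟨a, ha, b, hb, rfl⟩ := W.exists_homogeneous_add w
    rw [map_add, W.parityMap_of_mem_zero ha, W.parityMap_of_mem_one hb, map_add, map_add, map_neg,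
      map_add, (h0 a).1 ha, (h1 b).1 hb]
  have hfφ : IsSignTwisted n (f.restrictScalars ℂ ∘ₗ φ) := fun σ x => by
    simp only [LinearMap.comp_apply, hφ σ x, map_smul, LinearMap.coe_restrictScalars]
  let k : S →ₗ[GroupAlgSn n] V.carrier :=
    linearOfEquivariant (V.parityMap ∘ₗ f.restrictScalars ℂ ∘ₗ φ)
      (hfφ.comp V.parityMap_isSignTwisted)
  have hk : ∀ x, k x = V.parityMap (f (φ x)) := fun x => rfl
  -- Both $f\pm k$ are module maps, intertwining $\phi$ with plus or minus the parity map of $V$.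
  -- They cannot both vanish, since their sum is $2f$.
  by_cases hplus : f + k = 0
  · let g : S →ₗ[GroupAlgSn n] V.carrier := f - k
    have hg0 : g ≠ 0 := by
      intro h
      refine hf (LinearMap.ext fun x => ?_)
      have h2 : (2 : ℂ) • f x = 0 := by
        have h3 := LinearMap.congr_fun h x
        have h4 := LinearMap.congr_fun hplus x
        simp only [g, LinearMap.sub_apply, LinearMap.add_apply, LinearMap.zero_apply] at h3 h4
        rw [two_smul]
        calc f x + f x = (f x - k x) + (f x + k x) := by abel
          _ = 0 := by rw [h3, h4, add_zero]
      exact (smul_eq_zero.1 h2).resolve_left two_ne_zero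
    have hparity : ∀ x, V.parityMap (g x) = -g (φ x) := by
      intro x
      simp only [g, LinearMap.sub_apply, hk, map_sub, V.parityMap_parityMap, hφφ, neg_sub]
    have hsurj : Function.Surjective g := hV.surjective g hg0 fun x =>
      ⟨-φ x, by rw [hparity, map_neg]⟩
    have hinj : Function.Injective g := g.injective_or_eq_zero.resolve_right hg0
    have hφbij : Function.Bijective φ := Function.Involutive.bijective hφφ
    -- The map $f-k$ reverses parity but is not twisted; composing with $\phi$ supplies the sign
    -- that an odd map must carry.
    refine Supermodule.homogeneouslyIsomorphic_of_bijective 1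
      (g.restrictScalars ℂ ∘ₗ φ ∘ₗ e.toLinearMap.restrictScalars ℂ) ?_ ?_ ?_
    · exact Function.Bijective.comp (g := g) ⟨hinj, hsurj⟩ (hφbij.comp e.bijective)
    · intro σ w
      simp only [LinearMap.comp_apply, LinearMap.coe_restrictScalars, LinearEquiv.coe_coe,
        map_smul, hφ σ, ZMod.val_one, pow_one]
    · intro w
      simp only [LinearMap.comp_apply, LinearMap.coe_restrictScalars, LinearEquiv.coe_coe,
        hparity, hparW, ZMod.val_one, pow_one, neg_smul, one_smul, neg_neg]
  · let g : S →ₗ[GroupAlgSn n] V.carrier := f + k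
    have hparity : ∀ x, V.parityMap (g x) = g (φ x) := by
      intro x
      simp only [g, LinearMap.add_apply, hk, map_add, V.parityMap_parityMap, hφφ]
      exact add_comm _ _
    have hsurj : Function.Surjective g := hV.surjective g hplus fun x => ⟨φ x, hparity x⟩
    have hinj : Function.Injective g := g.injective_or_eq_zero.resolve_right hplus
    refine Supermodule.homogeneouslyIsomorphic_of_bijective 0
      (g.restrictScalars ℂ ∘ₗ e.toLinearMap.restrictScalars ℂ) ?_ ?_ ?_
    · exact Function.Bijective.comp (g := g) ⟨hinj, hsurj⟩ e.bijective
    · intro σ w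
      simp
    · intro w
      simp only [LinearMap.comp_apply, LinearMap.coe_restrictScalars, LinearEquiv.coe_coe,
        hparity, hparW, ZMod.val_zero, pow_zero, one_smul]

end TypeM

/-! ### The supermodules attached to partitions -/

section Associators

variable {n : ℕ} {φ : ∀ μ : Ptn n, specht μ →ₗ[ℂ] specht μ.conj}

/-- Transports values of the family along equalities of partitions, such as $\mu''=\mu$, that are
not definitional. -/
theorem associator_coe_congr (φ : ∀ μ : Ptn n, specht μ →ₗ[ℂ] specht μ.conj) {μ ν : Ptn n}
    (h : μ = ν) {x : specht μ} {y : specht ν} (hxy : (x : TabloidModule n) = y) :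
    (φ μ x : TabloidModule n) = φ ν y := by
  subst h
  rw [Subtype.ext hxy]

theorem IsAssociatorFamily.isSignTwisted (hφ : IsAssociatorFamily φ) (μ : Ptn n) :
    IsSignTwisted n (φ μ) := hφ.1 μ

/-- The map from the Specht module of the conjugate partition that is inverse to `φ μ`. -/
def conjAssociator (φ : ∀ μ : Ptn n, specht μ →ₗ[ℂ] specht μ.conj) (μ : Ptn n) :
    specht μ.conj →ₗ[ℂ] specht μ :=
  (spechtConjConj μ).toLinearMap.restrictScalars ℂ ∘ₗ φ μ.conj

theorem coe_conjAssociator (μ : Ptn n) (y : specht μ.conj) :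
    (conjAssociator φ μ y : TabloidModule n) = φ μ.conj y := rfl

theorem IsAssociatorFamily.conjAssociator_isSignTwisted (hφ : IsAssociatorFamily φ) (μ : Ptn n) :
    IsSignTwisted n (conjAssociator φ μ) := fun σ x => by
  have h := congrArg Subtype.val (hφ.1 μ.conj σ x)
  exact Subtype.ext h

theorem IsAssociatorFamily.conjAssociator_apply (hφ : IsAssociatorFamily φ) (μ : Ptn n)
    (x : specht μ) : conjAssociator φ μ (φ μ x) = x :=
  Subtype.ext (hφ.2 μ x)

theorem IsAssociatorFamily.apply_conjAssociator (hφ : IsAssociatorFamily φ) (μ : Ptn n)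
    (y : specht μ.conj) : φ μ (conjAssociator φ μ y) = y :=
  Subtype.ext ((associator_coe_congr φ μ.conj_conj.symm (coe_conjAssociator μ y)).trans
    (hφ.2 μ.conj y))

/-- For a self-conjugate partition, `φ μ` as an endomorphism of the Specht module. -/
def selfAssociator (φ : ∀ μ : Ptn n, specht μ →ₗ[ℂ] specht μ.conj) {μ : Ptn n} (h : μ = μ.conj) :
    specht μ →ₗ[ℂ] specht μ :=
  (LinearEquiv.ofEq (specht μ.conj) (specht μ) (by rw [← h])).toLinearMap.restrictScalars ℂ ∘ₗ φ μ

theorem coe_selfAssociator {μ : Ptn n} (h : μ = μ.conj) (x : specht μ) :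
    (selfAssociator φ h x : TabloidModule n) = φ μ x := rfl

theorem IsAssociatorFamily.selfAssociator_isSignTwisted (hφ : IsAssociatorFamily φ) {μ : Ptn n}
    (h : μ = μ.conj) : IsSignTwisted n (selfAssociator φ h) := fun σ x => by
  have h := congrArg Subtype.val (hφ.1 μ σ x)
  exact Subtype.ext h

theorem IsAssociatorFamily.selfAssociator_selfAssociator (hφ : IsAssociatorFamily φ) {μ : Ptn n}
    (h : μ = μ.conj) (x : specht μ) : selfAssociator φ h (selfAssociator φ h x) = x :=
  Subtype.ext ((associator_coe_congr φ h (coe_selfAssociator h x)).trans (hφ.2 μ x))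

/-- The simple supermodule attached to a partition, together with its characterization. -/
theorem IsAssociatorFamily.exists_supermodule (hφ : IsAssociatorFamily φ) (μ : Ptn n) :
    ∃ W : Supermodule.{0} (snGrading n),
      (μ ≠ μ.conj → W.IsSimpleTypeQ ∧
        ∃ e : W.carrier ≃ₗ[GroupAlgSn n] (specht μ × specht μ.conj),
          (∀ w, w ∈ W.grade 0 ↔ ∃ x : specht μ, e w = (x, φ μ x)) ∧
          (∀ w, w ∈ W.grade 1 ↔ ∃ x : specht μ, e w = (x, -φ μ x))) ∧
      (μ = μ.conj → W.IsSimpleTypeM ∧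
        ∃ e : W.carrier ≃ₗ[GroupAlgSn n] specht μ,
          (∀ w, w ∈ W.grade 0 ↔ e w ∈ spechtEigen (φ μ) 1) ∧
          (∀ w, w ∈ W.grade 1 ↔ e w ∈ spechtEigen (φ μ) (-1))) ∧
      (∃ f : specht μ →ₗ[GroupAlgSn n] W.carrier, Function.Injective f) ∧
      (∀ (κ : Ptn n) (f : specht κ →ₗ[GroupAlgSn n] W.carrier), Function.Injective f →
        κ = μ ∨ κ = μ.conj) ∧
      ∀ V : Supermodule.{u} (snGrading n), V.IsSimple →
        ∀ f : specht μ →ₗ[GroupAlgSn n] V.carrier, f ≠ 0 → V.HomogeneouslyIsomorphic W := by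
  by_cases h : μ = μ.conj
  · obtain ⟨W, hW, e, h0, h1⟩ := exists_isSimpleTypeM (selfAssociator φ h)
      (hφ.selfAssociator_isSignTwisted h) (hφ.selfAssociator_selfAssociator h)
    refine ⟨W, fun hne => absurd h hne, fun _ => ⟨hW, e, fun w => ?_, fun w => ?_⟩,
      ⟨e.symm.toLinearMap, e.symm.injective⟩, fun κ f hf => ?_, fun V hV f hf => ?_⟩
    · rw [h0, Subtype.ext_iff, coe_selfAssociator]
      change _ ↔ (φ μ (e w) : TabloidModule n) = (1 : ℂ) • (e w : TabloidModule n)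
      rw [one_smul]
    · rw [h1, Subtype.ext_iff, coe_selfAssociator]
      change _ ↔ (φ μ (e w) : TabloidModule n) = (-1 : ℂ) • (e w : TabloidModule n)
      rw [neg_smul, one_smul]
      rfl
    · left
      let g : specht κ →ₗ[GroupAlgSn n] specht μ := e.toLinearMap ∘ₗ f
      have hg : Function.Injective g := e.injective.comp hf
      have hb : Function.Bijective g := g.bijective_or_eq_zero.resolve_right fun h0 => by
        have := IsSimpleModule.nontrivial (GroupAlgSn n) (specht κ)
        obtain ⟨x, hx⟩ := exists_ne (0 : specht κ)
        exact hx (hg (by rw [h0]; rfl))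
      exact eq_of_specht_equiv ⟨LinearEquiv.ofBijective g hb⟩
    · exact homogeneouslyIsomorphic_typeM (hφ.selfAssociator_isSignTwisted h)
        (hφ.selfAssociator_selfAssociator h) e h0 h1 hV f hf
  · have hne : ¬ Nonempty (specht μ ≃ₗ[GroupAlgSn n] specht μ.conj) := fun he =>
      h (eq_of_specht_equiv he)
    obtain ⟨W, hW, e, h0, h1⟩ := exists_isSimpleTypeQ hne (φ μ) (conjAssociator φ μ)
      (hφ.isSignTwisted μ) (hφ.conjAssociator_isSignTwisted μ) (hφ.conjAssociator_apply μ)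
      (hφ.apply_conjAssociator μ)
    refine ⟨W, fun _ => ⟨hW, e, h0, h1⟩, fun h' => absurd h' h,
      ⟨e.symm.toLinearMap ∘ₗ LinearMap.inl _ _ _, e.symm.injective.comp LinearMap.inl_injective⟩,
      fun κ f hf => ?_, fun V hV f hf => ?_⟩
    · by_contra hκ
      push Not at hκ
      have h1 := linearMap_eq_zero_of_not_equiv (fun he => hκ.1 (eq_of_specht_equiv he))
        (LinearMap.fst _ _ _ ∘ₗ e.toLinearMap ∘ₗ f)
      have h2 := linearMap_eq_zero_of_not_equiv (fun he => hκ.2 (eq_of_specht_equiv he))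
        (LinearMap.snd _ _ _ ∘ₗ e.toLinearMap ∘ₗ f)
      have := IsSimpleModule.nontrivial (GroupAlgSn n) (specht κ)
      obtain ⟨x, hx⟩ := exists_ne (0 : specht κ)
      have h3 : e (f x) = 0 :=
        Prod.ext (LinearMap.congr_fun h1 x) (LinearMap.congr_fun h2 x)
      rw [e.map_eq_zero_iff] at h3
      exact hx (hf (h3.trans (map_zero f).symm))
    · exact homogeneouslyIsomorphic_typeQ e hW.1 (hφ.conjAssociator_isSignTwisted μ)
        (hφ.conjAssociator_apply μ) h0 h1 hV f hf

/-- By Maschke's theorem the nonzero underlying module has a simple submodule, necessarily a Specht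
module. -/
theorem Supermodule.IsSimple.exists_specht_injective {V : Supermodule.{u} (snGrading n)}
    (hV : V.IsSimple) :
    ∃ (κ : Ptn n) (f : specht κ →ₗ[GroupAlgSn n] V.carrier), Function.Injective f := by
  have := hV.1
  obtain ⟨N, hN⟩ := IsSemisimpleModule.exists_simple_submodule (GroupAlgSn n) V.carrier
  obtain ⟨κ, ⟨e⟩⟩ := exists_specht_equiv (n := n) N
  exact ⟨κ, N.subtype ∘ₗ e.symm.toLinearMap, N.injective_subtype.comp e.symm.injective⟩

/-- An embedding of a Specht module followed by an injective sign-twisted map yields an embedding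
of the Specht module of the conjugate partition. -/
theorem IsAssociatorFamily.exists_conj_injective (hφ : IsAssociatorFamily φ)
    {V : Type v} [AddCommGroup V] [Module ℂ V] [Module (GroupAlgSn n) V]
    [IsScalarTower ℂ (GroupAlgSn n) V] {U : Type w} [AddCommGroup U] [Module ℂ U]
    [Module (GroupAlgSn n) U] [IsScalarTower ℂ (GroupAlgSn n) U] {κ : Ptn n}
    {f : specht κ →ₗ[GroupAlgSn n] V} (hf : Function.Injective f) {F : V →ₗ[ℂ] U}
    (hF : IsSignTwisted n F) (hFi : Function.Injective F) :
    ∃ g : specht κ.conj →ₗ[GroupAlgSn n] U, Function.Injective g := by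
  have hψ : IsSignTwisted n (f.restrictScalars ℂ ∘ₗ conjAssociator φ κ) := fun σ x => by
    simp only [LinearMap.comp_apply, hφ.conjAssociator_isSignTwisted κ σ x, map_smul,
      LinearMap.coe_restrictScalars]
  have hψi : Function.Injective (conjAssociator φ κ) :=
    Function.LeftInverse.injective (hφ.apply_conjAssociator κ)
  exact ⟨linearOfEquivariant (F ∘ₗ _) (hψ.comp hF), hFi.comp (hf.comp hψi)⟩

theorem ne_zero_of_specht_injective {V : Type v} [AddCommGroup V] [Module (GroupAlgSn n) V]
    {κ : Ptn n} {f : specht κ →ₗ[GroupAlgSn n] V} (hf : Function.Injective f) : f ≠ 0 := by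
  rintro rfl
  have := IsSimpleModule.nontrivial (GroupAlgSn n) (specht κ)
  obtain ⟨x, hx⟩ := exists_ne (0 : specht κ)
  exact hx (hf rfl)

theorem IsConjRepresentatives.eq {R : Set (Ptn n)} (hR : IsConjRepresentatives R) {μ ν : Ptn n}
    (hμ : μ ∈ R) (hν : ν ∈ R) (h : μ = ν ∨ μ = ν.conj) : μ = ν :=
  (hR ν).unique ⟨hμ, h⟩ ⟨hν, Or.inl rfl⟩

end Associators

end

theorem mainTheorem4 (n : ℕ) (hn : 1 < n) :
    (∃ φ : ∀ μ : Ptn n, specht μ →ₗ[ℂ] specht μ.conj, IsAssociatorFamily φ) ∧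
    ∀ φ : ∀ μ : Ptn n, specht μ →ₗ[ℂ] specht μ.conj, IsAssociatorFamily φ →
    ∀ R : Set (Ptn n), IsConjRepresentatives R →
    ∃ W : R → Supermodule.{0} (snGrading n),
      (∀ μ : R, μ.1 ≠ μ.1.conj →
        (W μ).IsSimpleTypeQ ∧
        ∃ e : (W μ).carrier ≃ₗ[GroupAlgSn n] (specht μ.1 × specht μ.1.conj),
          (∀ w, w ∈ (W μ).grade 0 ↔ ∃ x : specht μ.1, e w = (x, φ μ.1 x)) ∧
          (∀ w, w ∈ (W μ).grade 1 ↔ ∃ x : specht μ.1, e w = (x, -φ μ.1 x)) ∧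
          -- the decomposition is canonical: the two summands are the only submodules of their
          -- isomorphism types
          (∀ N : Submodule (GroupAlgSn n) (W μ).carrier,
            Nonempty (N ≃ₗ[GroupAlgSn n] specht μ.1) ↔ ∀ w, w ∈ N ↔ (e w).2 = 0) ∧
          (∀ N : Submodule (GroupAlgSn n) (W μ).carrier,
            Nonempty (N ≃ₗ[GroupAlgSn n] specht μ.1.conj) ↔ ∀ w, w ∈ N ↔ (e w).1 = 0) ∧
          (∃! J : (W μ).carrier →ₗ[ℂ] (W μ).carrier, ∀ x : specht μ.1,
            J (e.symm (x, φ μ.1 x)) = e.symm (x, -φ μ.1 x) ∧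
            J (e.symm (x, -φ μ.1 x)) = e.symm (x, φ μ.1 x)) ∧
          (∀ J : (W μ).carrier →ₗ[ℂ] (W μ).carrier, (∀ x : specht μ.1,
            J (e.symm (x, φ μ.1 x)) = e.symm (x, -φ μ.1 x) ∧
            J (e.symm (x, -φ μ.1 x)) = e.symm (x, φ μ.1 x)) → (W μ).IsOddInvolution J)) ∧
      (∀ μ : R, μ.1 = μ.1.conj →
        (W μ).IsSimpleTypeM ∧
        ∃ e : (W μ).carrier ≃ₗ[GroupAlgSn n] specht μ.1,
          (∀ w, w ∈ (W μ).grade 0 ↔ e w ∈ spechtEigen (φ μ.1) 1) ∧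
          (∀ w, w ∈ (W μ).grade 1 ↔ e w ∈ spechtEigen (φ μ.1) (-1))) ∧
      (∀ μ ν : R, (W μ).HomogeneouslyIsomorphic (W ν) → μ = ν) ∧
      (∀ V : Supermodule.{u} (snGrading n), V.IsSimple →
        ∃ μ : R, V.HomogeneouslyIsomorphic (W μ)) := by
  refine ⟨exists_associatorFamily n, fun φ hφ R hR => ?_⟩
  choose W hQ hM hinj hfactor hcomplete using
    fun μ : R => hφ.exists_supermodule.{u} μ.1
  refine ⟨W, fun μ hμ => ?_, hM, fun μ ν h => ?_, fun V hV => ?_⟩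
  · have hne : ¬ Nonempty (specht μ.1 ≃ₗ[GroupAlgSn n] specht μ.1.conj) := fun he =>
      hμ (eq_of_specht_equiv he)
    obtain ⟨hW, e, h0, h1⟩ := hQ μ hμ
    obtain ⟨hJ, hJ'⟩ := existsUnique_oddInvolution (S := specht μ.1) (S' := specht μ.1.conj)
      (φ := φ μ.1) e h0 h1
    exact ⟨hW, e, h0, h1,
      nonempty_equiv_fst_iff (S := specht μ.1) (S' := specht μ.1.conj) hne e,
      nonempty_equiv_snd_iff (S := specht μ.1) (S' := specht μ.1.conj) hne e, hJ, hJ'⟩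
  · refine Subtype.ext (hR.eq μ.2 ν.2 ?_)
    obtain ⟨i, hi⟩ := hinj μ
    rcases h.exists_bijective with ⟨f, hf⟩ | ⟨f, hft, hf⟩
    · exact hfactor ν μ.1 (f ∘ₗ i) (hf.1.comp hi)
    -- An odd isomorphism turns the constituent $S^\mu$ into $S^{\mu'}$, which still determines the
    -- class $\{\mu,\mu'\}$.
    · obtain ⟨g, hg⟩ := hφ.exists_conj_injective hi hft hf.1
      have h' := hfactor ν μ.1.conj g hg
      rcases h' with h' | h'
      · right
        rw [← h', Ptn.conj_conj]
      · left
        rw [← μ.1.conj_conj, h', Ptn.conj_conj]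
  · obtain ⟨κ, f, hf⟩ := hV.exists_specht_injective
    obtain ⟨ν, ⟨hνR, hν⟩, -⟩ := hR κ
    rcases hν with rfl | rfl
    · exact ⟨⟨ν, hνR⟩, hcomplete ⟨ν, hνR⟩ V hV f (ne_zero_of_specht_injective hf)⟩
    -- When the representative is $\kappa'$, the parity map of $V$ turns the copy of $S^\kappa$ into
    -- one of $S^{\kappa'}$.
    · obtain ⟨g, hg⟩ := hφ.exists_conj_injective hf V.parityMap_isSignTwisted
        (Function.LeftInverse.injective V.parityMap_parityMap)
      exact ⟨⟨_, hνR⟩, hcomplete ⟨_, hνR⟩ V hV g (ne_zero_of_specht_injective hg)⟩
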